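/- Let $n\ge 1$ be an integer, let $p,q,s$ be real numbers with $p\ge q>1$, $s>p-1$ and $$(n-q)\,s\le n(q-1),$$ and let $u\in W^{1,p}_{\mathrm{loc}}(\mathbb R^n)\cap L^s_{\mathrm{loc}}(\mathbb R^n)$ be a nonnegative weak solution of $$\Delta_p u+\Delta_q u+u^s\le 0\quad\text{on }\mathbb R^n,\qquad \Delta_z u=\operatorname{div}\big(|\nabla u|^{z-2}\nabla u\big)\ \ (z\in\{p,q\}),$$ that is, $u\ge 0$ a.e. and, for every $\psi\in W^{1,p}(\mathbb R^n)\cap L^\infty(\mathbb R^n)$ with compact support and $\psi\ge 0$ a.e., $$-\int_{\mathbb R^n}|\nabla u|^{p-2}\langle\nabla u,\nabla\psi\rangle\,dx-\int_{\mathbb R^n}|\nabla u|^{q-2}\langle\nabla u,\nabla\psi\rangle\,dx+\int_{\mathbb R^n}u^s\psi\,dx\le 0 .$$ Here $\mathbb R^n$ carries the Euclidean metric and Lebesgue measure, $\nabla$ is the weak gradient, and $|\nabla u|^{z-2}\nabla u$ is read as $0$ where $\nabla u=0$. Then $u=0$ a.e. on $\mathbb R^n$. (If $q\ge n$, the condition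 $(n-q)s\le n(q-1)$ holds automatically.) -/

import Mathlib

open MeasureTheory
open scoped ENNReal ContDiff

/-- `f ∈ L^r_loc(ℝⁿ)`: the function `f` is in `L^r` on every compact set (real exponent `r > 0`). -/
def MemLpLoc {n : ℕ} {F : Type*} [NormedAddCommGroup F]
    (f : EuclideanSpace ℝ (Fin n) → F) (r : ℝ) : Prop :=
  ∀ K : Set (EuclideanSpace ℝ (Fin n)), IsCompact K →
    MemLp f (ENNReal.ofReal r) (volume.restrict K)

/-- `G` is the weak (distributional) gradient of `u` on `ℝⁿ`: both are locally integrable and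
`∫ u ∂ᵥφ = - ∫ ⟨G, v⟩ φ` for every test function `φ ∈ C_c^∞(ℝⁿ)` and every vector `v`. -/
def HasWeakGradient {n : ℕ} (u : EuclideanSpace ℝ (Fin n) → ℝ)
    (G : EuclideanSpace ℝ (Fin n) → EuclideanSpace ℝ (Fin n)) : Prop :=
  LocallyIntegrable u volume ∧ LocallyIntegrable G volume ∧
    ∀ φ : EuclideanSpace ℝ (Fin n) → ℝ, ContDiff ℝ ∞ φ → HasCompactSupport φ →
      ∀ v : EuclideanSpace ℝ (Fin n),
        ∫ x, u x * fderiv ℝ φ x v = - ∫ x, inner ℝ (G x) v * φ x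

/-- `u ∈ W^{1,r}_loc(ℝⁿ)` with weak gradient `G`. -/
def MemW1Loc {n : ℕ} (r : ℝ) (u : EuclideanSpace ℝ (Fin n) → ℝ)
    (G : EuclideanSpace ℝ (Fin n) → EuclideanSpace ℝ (Fin n)) : Prop :=
  HasWeakGradient u G ∧ MemLpLoc u r ∧ MemLpLoc G r

/-- `ψ ∈ W^{1,r}(ℝⁿ)` with weak gradient `H`. -/
def MemW1 {n : ℕ} (r : ℝ) (ψ : EuclideanSpace ℝ (Fin n) → ℝ)
    (H : EuclideanSpace ℝ (Fin n) → EuclideanSpace ℝ (Fin n)) : Prop :=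
  HasWeakGradient ψ H ∧ MemLp ψ (ENNReal.ofReal r) volume ∧ MemLp H (ENNReal.ofReal r) volume

/-- `u ∈ W^{1,p}_loc(ℝⁿ) ∩ L^s_loc(ℝⁿ)` is a nonnegative weak solution of
`Δ_p u + Δ_q u + u^s ≤ 0` on `ℝⁿ`; here `G` plays the role of `∇u` and `H` that of `∇ψ`
(weak gradients are unique almost everywhere). -/
def IsNonnegWeakSolution {n : ℕ} (p q s : ℝ) (u : EuclideanSpace ℝ (Fin n) → ℝ) : Prop :=
  (∀ᵐ x, 0 ≤ u x) ∧ MemLpLoc u s ∧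
    ∃ G : EuclideanSpace ℝ (Fin n) → EuclideanSpace ℝ (Fin n), MemW1Loc p u G ∧
      ∀ (ψ : EuclideanSpace ℝ (Fin n) → ℝ)
        (H : EuclideanSpace ℝ (Fin n) → EuclideanSpace ℝ (Fin n)),
        MemW1 p ψ H → MemLp ψ ∞ volume → HasCompactSupport ψ → (∀ᵐ x, 0 ≤ ψ x) →
          - (∫ x, ‖G x‖ ^ (p - 2) * inner ℝ (G x) (H x))
            - (∫ x, ‖G x‖ ^ (q - 2) * inner ℝ (G x) (H x))
            + ∫ x, u x ^ s * ψ x ≤ 0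

/-! The proof uses nonlinear capacity. Testing the inequality with `(u + ε) ^ (-τ) * η`, for a
cutoff `η` between the balls of radii `R` and `2R`, bounds the source plus `τ` times weighted
gradient energies by the fluxes `∫ |∇u|^(z-1) (u + ε)^(-τ) |∇η|`, `z ∈ {p, q}` (`energy_le`). Each
flux is split by a three-factor Young inequality (`flux_young`) into gradient energy, source, and a
pure power of `R`.

The test is used twice. With a small `τ = t > 0`, energy and source are absorbed on the left, and
the weighted energies grow at most like `R^(n t / s)`, up to an error that vanishes with `ε`
(`exists_integral_grad_le`). With `τ = 0` the left side is `∫ u^s η`; this energy bound is inserted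
into the flux, and criticality `n (s - z + 1) ≤ z s` makes all powers of `R` cancel or decay. Since
`∇η` lives on an annulus, there remains (`exists_integral_source_le`) `∫ u^s η ≤ C a + C b ∫_annulus
u^s η + C (a^c₁ b^(-c₂) + a^c₃ b^(-c₄))` for all `a, b > 0` and `R ≥ 1`, with `c₂, c₄ > 0`.

A small `b` gives `u^s ∈ L¹`, so the annulus term tends to zero as `R → ∞`. Then `b → ∞`, and
finally `a → 0`, give `∫ u^s = 0`. Keeping `a` and `b` independent is what includes the critical
case of equality.

That the test function is admissible rests on a chain rule for weak gradients, proved by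
mollification. -/

open Filter Topology
open scoped Convolution

set_option linter.unusedSectionVars false

/-! ### Mollification: almost everywhere and `L¹` convergence, derivatives. -/

section Mollification

variable {E : Type*} [NormedAddCommGroup E] [NormedSpace ℝ E] [FiniteDimensional ℝ E]
  [MeasurableSpace E] [BorelSpace E] {μ : Measure E} [μ.IsAddHaarMeasure]

/-- A sequence of bump functions at the origin with radii tending to zero. -/
noncomputable def shrinkingBump (E : Type*) [NormedAddCommGroup E] (j : ℕ) :
    ContDiffBump (0 : E) where
  rIn := 1 / (2 * ((j : ℝ) + 1))
  rOut := 1 / ((j : ℝ) + 1)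
  rIn_pos := by positivity
  rIn_lt_rOut := by
    apply one_div_lt_one_div_of_lt <;> nlinarith [Nat.cast_nonneg (α := ℝ) j]

theorem shrinkingBump_rOut_tendsto :
    Tendsto (fun j => (shrinkingBump E j).rOut) atTop (𝓝 0) :=
  tendsto_one_div_add_atTop_nhds_zero_nat

theorem shrinkingBump_rOut_le_one (j : ℕ) : (shrinkingBump E j).rOut ≤ 1 := by
  change 1 / ((j : ℝ) + 1) ≤ 1
  rw [div_le_one (by positivity)]
  linarith [Nat.cast_nonneg (α := ℝ) j]

/-- Mollification of `g` at scale `1 / (j + 1)`. -/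
noncomputable def mollify (μ : Measure E) (j : ℕ) (g : E → ℝ) : E → ℝ :=
  (shrinkingBump E j).normed μ ⋆[ContinuousLinearMap.lsmul ℝ ℝ, μ] g

theorem mollify_apply (j : ℕ) (g : E → ℝ) (x : E) :
    mollify μ j g x = ∫ y, (shrinkingBump E j).normed μ y * g (x - y) ∂μ := rfl

theorem mollify_nonneg (j : ℕ) {g : E → ℝ} (hg : ∀ x, 0 ≤ g x) (x : E) :
    0 ≤ mollify μ j g x :=
  integral_nonneg fun y => mul_nonneg ((shrinkingBump E j).nonneg_normed y) (hg _)

theorem ae_tendsto_mollify {g : E → ℝ} (hg : LocallyIntegrable g μ) :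
    ∀ᵐ x ∂μ, Tendsto (fun j => mollify μ j g x) atTop (𝓝 (g x)) := by
  refine ContDiffBump.ae_convolution_tendsto_right_of_locallyIntegrable (K := 2)
    shrinkingBump_rOut_tendsto (Eventually.of_forall fun j => ?_) hg
  change 1 / ((j : ℝ) + 1) ≤ 2 * (1 / (2 * ((j : ℝ) + 1)))
  apply le_of_eq
  field_simp

theorem integrable_mollify (j : ℕ) {g : E → ℝ} (hg : Integrable g μ) :
    Integrable (mollify μ j g) μ :=
  ((shrinkingBump E j).integrable_normed).integrable_convolution _ hg

theorem integral_mollify (j : ℕ) {g : E → ℝ} (hg : Integrable g μ) :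
    ∫ x, mollify μ j g x ∂μ = ∫ x, g x ∂μ := by
  unfold mollify
  rw [integral_convolution _ ((shrinkingBump E j).integrable_normed) hg]
  simp [(shrinkingBump E j).integral_normed]

/-- Scheffé's argument: mollification preserves the integral, so the `L¹` distance is twice the
integral of the positive part of `g - mollify μ j g`. That part is dominated by `g` and tends to
zero almost everywhere. -/
theorem tendsto_integral_abs_mollify_sub_of_nonneg {g : E → ℝ} (hg : Integrable g μ)
    (h0 : ∀ x, 0 ≤ g x) :
    Tendsto (fun j => ∫ x, |mollify μ j g x - g x| ∂μ) atTop (𝓝 0) := by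
  have key : ∀ j, ∫ x, |mollify μ j g x - g x| ∂μ
      = 2 * ∫ x, max (g x - mollify μ j g x) 0 ∂μ := by
    intro j
    have hj := integrable_mollify (μ := μ) j hg
    have e : ∀ x, |mollify μ j g x - g x|
        = (mollify μ j g x - g x) + 2 * max (g x - mollify μ j g x) 0 := by
      intro x
      rcases le_total (g x) (mollify μ j g x) with h | h
      · rw [abs_of_nonneg (by linarith), max_eq_right (by linarith)]; ring
      · rw [abs_of_nonpos (by linarith), max_eq_left (by linarith)]; ring
    simp_rw [e]
    have i1 : Integrable (fun x => mollify μ j g x - g x) μ := hj.sub hg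
    have i2 : Integrable (fun x => 2 * max (g x - mollify μ j g x) 0) μ :=
      (hg.sub hj).pos_part.const_mul 2
    rw [integral_add i1 i2, integral_sub hj hg, integral_mollify j hg, integral_const_mul]
    simp
  simp_rw [key]
  have e0 : (0 : ℝ) = 2 * ∫ x, (0 : ℝ) ∂μ := by simp
  conv => enter [3]; rw [e0]
  refine Tendsto.const_mul 2 (tendsto_integral_of_dominated_convergence g
    (fun j => (hg.sub (integrable_mollify j hg)).pos_part.aestronglyMeasurable) hg ?_ ?_)
  · intro j
    refine Eventually.of_forall fun x => ?_
    rw [Real.norm_of_nonneg (le_max_right _ _)]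
    exact max_le (by linarith [mollify_nonneg (μ := μ) j h0 x]) (h0 x)
  · filter_upwards [ae_tendsto_mollify hg.locallyIntegrable] with x hx
    have := (tendsto_const_nhds (x := g x)).sub hx
    simpa using this.max (tendsto_const_nhds (x := (0 : ℝ)))

theorem mollify_sub (j : ℕ) {f g : E → ℝ} (hf : LocallyIntegrable f μ)
    (hg : LocallyIntegrable g μ) (x : E) :
    mollify μ j (fun y => f y - g y) x = mollify μ j f x - mollify μ j g x := by
  have H : ∀ {h : E → ℝ}, LocallyIntegrable h μ →
      Integrable (fun y => (shrinkingBump E j).normed μ y * h (x - y)) μ := fun hh =>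
    ((shrinkingBump E j).hasCompactSupport_normed.convolutionExists_left
      (ContinuousLinearMap.lsmul ℝ ℝ) (shrinkingBump E j).continuous_normed hh x)
  simp only [mollify_apply, mul_sub]
  exact integral_sub (H hf) (H hg)

theorem tendsto_integral_abs_mollify_sub {g : E → ℝ} (hg : Integrable g μ) :
    Tendsto (fun j => ∫ x, |mollify μ j g x - g x| ∂μ) atTop (𝓝 0) := by
  have h1 := tendsto_integral_abs_mollify_sub_of_nonneg hg.pos_part fun x => le_max_right _ _
  have h2 := tendsto_integral_abs_mollify_sub_of_nonneg hg.neg_part fun x => le_max_right _ _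
  refine squeeze_zero (fun j => integral_nonneg fun x => abs_nonneg _) (fun j => ?_)
    (by simpa using h1.add h2)
  have i1 : Integrable (fun x => |mollify μ j (fun a => max (g a) 0) x - max (g x) 0|) μ :=
    ((integrable_mollify j hg.pos_part).sub hg.pos_part).abs
  have i2 : Integrable (fun x => |mollify μ j (fun a => max (-g a) 0) x - max (-g x) 0|) μ :=
    ((integrable_mollify j hg.neg_part).sub hg.neg_part).abs
  rw [← integral_add i1 i2]
  refine integral_mono ((integrable_mollify j hg).sub hg).abs (i1.add i2) fun x => ?_
  have e : g = fun y => max (g y) 0 - max (-g y) 0 := by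
    funext y
    rcases le_total (g y) 0 with h | h
    · rw [max_eq_right h, max_eq_left (by linarith)]; ring
    · rw [max_eq_left h, max_eq_right (by linarith)]; ring
  have e1 : mollify μ j g x
      = mollify μ j (fun y => max (g y) 0) x - mollify μ j (fun y => max (-g y) 0) x := by
    conv_lhs => rw [e]
    exact mollify_sub j hg.pos_part.locallyIntegrable hg.neg_part.locallyIntegrable x
  have e2 := congrFun e x
  rw [e1]
  conv_lhs => rw [e2]
  exact (congrArg abs (by ring)).trans_le (abs_sub _ _)

/-- All kernels are supported in the unit ball; this allows a locally integrable function to be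
truncated before it is mollified. -/
theorem mollify_congr (j : ℕ) {f g : E → ℝ} {x : E}
    (h : ∀ y ∈ Metric.ball x 1, f y = g y) : mollify μ j f x = mollify μ j g x := by
  simp only [mollify_apply]
  congr 1
  funext y
  by_cases hy : y ∈ Metric.ball (0 : E) (shrinkingBump E j).rOut
  · rw [h]
    have := lt_of_lt_of_le (mem_ball_zero_iff.1 hy) (shrinkingBump_rOut_le_one j)
    simpa [Metric.mem_ball, dist_eq_norm] using this
  · have : (shrinkingBump E j).normed μ y = 0 := by
      rw [← Function.notMem_support, ContDiffBump.support_normed_eq]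
      exact hy
    simp [this]

theorem contDiff_mollify (j : ℕ) {g : E → ℝ} (hg : LocallyIntegrable g μ) :
    ContDiff ℝ ∞ (mollify μ j g) :=
  (shrinkingBump E j).hasCompactSupport_normed.contDiff_convolution_left _
    (shrinkingBump E j).contDiff_normed hg

theorem mollify_eq_integral_sub (j : ℕ) (g : E → ℝ) (x : E) :
    mollify μ j g x = ∫ y, (shrinkingBump E j).normed μ (x - y) * g y ∂μ := by
  unfold mollify
  rw [convolution_eq_swap]
  rfl

theorem fderiv_mollify (j : ℕ) {g : E → ℝ} (hg : LocallyIntegrable g μ) (x v : E) :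
    fderiv ℝ (mollify μ j g) x v
      = ∫ y, fderiv ℝ ((shrinkingBump E j).normed μ) (x - y) v * g y ∂μ := by
  have hc := (shrinkingBump E j).hasCompactSupport_normed (μ := μ)
  have hs : ContDiff ℝ 1 ((shrinkingBump E j).normed μ) := (shrinkingBump E j).contDiff_normed
  have h := hc.hasFDerivAt_convolution_left (ContinuousLinearMap.lsmul ℝ ℝ) hs hg x
  have hi : Integrable (fun y => ((ContinuousLinearMap.lsmul ℝ ℝ).precompL E)
      (fderiv ℝ ((shrinkingBump E j).normed μ) (x - y)) (g y)) μ :=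
    ConvolutionExistsAt.integrable_swap ((hc.fderiv ℝ).convolutionExists_left _
      (hs.continuous_fderiv one_ne_zero) hg x)
  unfold mollify
  rw [h.fderiv, convolution_eq_swap, ContinuousLinearMap.integral_apply hi]
  rfl

end Mollification

/-! ### Chain and product rules for weak gradients. -/

section WeakGradient

variable {n : ℕ} {u : EuclideanSpace ℝ (Fin n) → ℝ}
  {G : EuclideanSpace ℝ (Fin n) → EuclideanSpace ℝ (Fin n)}

theorem MeasureTheory.LocallyIntegrable.inner_const_right (hG : LocallyIntegrable G volume)
    (v : EuclideanSpace ℝ (Fin n)) :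
    LocallyIntegrable (fun x => inner ℝ (G x) v) volume := by
  intro x
  obtain ⟨U, hU, hi⟩ := hG x
  exact ⟨U, hU, hi.inner_const v⟩

/-- The weak gradient identity is tested with `y ↦ ρ (x - y)`; the sign from the reflection cancels
the one from integration by parts. -/
theorem HasWeakGradient.fderiv_mollify (h : HasWeakGradient u G) (j : ℕ)
    (x v : EuclideanSpace ℝ (Fin n)) :
    fderiv ℝ (mollify volume j u) x v = mollify volume j (fun y => inner ℝ (G y) v) x := by
  rw [_root_.fderiv_mollify j h.1, mollify_eq_integral_sub]
  set ρ := (shrinkingBump (EuclideanSpace ℝ (Fin n)) j).normed volume with hρ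
  have hs : ContDiff ℝ ∞ ρ := (shrinkingBump _ j).contDiff_normed
  have hc : HasCompactSupport ρ := (shrinkingBump _ j).hasCompactSupport_normed
  have h1 := h.2.2 (fun y => ρ (x - y)) (hs.comp (contDiff_const.sub contDiff_id))
    (hc.comp_homeomorph (Homeomorph.subLeft x)) v
  have h2 : ∀ y, fderiv ℝ (fun y => ρ (x - y)) y v = -(fderiv ℝ ρ (x - y) v) := by
    intro y
    have d : HasFDerivAt (fun y => ρ (x - y))
        ((fderiv ℝ ρ (x - y)).comp (-(ContinuousLinearMap.id ℝ _))) y :=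
      ((hs.differentiable (by simp)) (x - y)).hasFDerivAt.comp y ((hasFDerivAt_id y).const_sub x)
    rw [d.fderiv]
    simp
  simp only [h2, mul_neg, integral_neg, neg_inj] at h1
  simpa only [mul_comm] using h1

variable {f f' : ℝ → ℝ} {C : ℝ}

theorem aestronglyMeasurable_comp_of_continuousOn_Ici {f : ℝ → ℝ}
    (hf : ContinuousOn f (Set.Ici 0)) (hu : ∀ x, 0 ≤ u x)
    (hm : AEStronglyMeasurable u volume) : AEStronglyMeasurable (fun x => f (u x)) volume := by
  have hc : Continuous (fun y : ℝ => f (max y 0)) :=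
    hf.comp_continuous (by fun_prop) fun y => Set.mem_Ici.2 (le_max_right _ _)
  have := hc.comp_aestronglyMeasurable hm
  refine this.congr (Eventually.of_forall fun x => ?_)
  simp [max_eq_left (hu x)]

/-- Chain rule for weak gradients of nonnegative functions. -/
theorem HasWeakGradient.integral_comp (h : HasWeakGradient u G) (hu : ∀ x, 0 ≤ u x)
    (hf : ∀ y, 0 ≤ y → HasDerivAt f (f' y) y) (hf'c : ContinuousOn f' (Set.Ici 0))
    (hfC : ∀ y, 0 ≤ y → |f y| ≤ C) (hf'C : ∀ y, 0 ≤ y → |f' y| ≤ C)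
    {φ : EuclideanSpace ℝ (Fin n) → ℝ} (hφ : ContDiff ℝ ∞ φ) (hφc : HasCompactSupport φ)
    (v : EuclideanSpace ℝ (Fin n)) :
    ∫ x, f (u x) * fderiv ℝ φ x v = - ∫ x, f' (u x) * inner ℝ (G x) v * φ x := by
  have hC : 0 ≤ C := (abs_nonneg _).trans (hfC 0 le_rfl)
  have hfc : ContinuousOn f (Set.Ici 0) := fun y hy => (hf y hy).continuousAt.continuousWithinAt
  have hum := h.1.aestronglyMeasurable
  set g : EuclideanSpace ℝ (Fin n) → ℝ := fun x => inner ℝ (G x) v with hg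
  have hgl : LocallyIntegrable g volume := h.2.1.inner_const_right v
  set K := tsupport φ with hK
  have hKc : IsCompact K := hφc
  set K' := Metric.cthickening 1 K with hK'
  have hK'c : IsCompact K' := hKc.cthickening
  -- The truncation is globally integrable and equals `g` within distance 1 of the support of `φ`,
  -- so on that support both have the same mollifications.
  set g₀ := K'.indicator g with hg₀
  have hg₀i : Integrable g₀ volume :=
    (hgl.integrableOn_isCompact hK'c).integrable_indicator hK'c.isClosed.measurableSet
  set uj := fun j => mollify volume j u with huj
  have huj0 : ∀ j x, 0 ≤ uj j x := fun j x => mollify_nonneg j hu x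
  have hujs : ∀ j, ContDiff ℝ ∞ (uj j) := fun j => contDiff_mollify j h.1
  have hφ0 : ∀ x, x ∉ K → φ x = 0 := fun x hx => image_eq_zero_of_notMem_tsupport hx
  obtain ⟨D, hD⟩ := hφc.exists_bound_of_continuous hφ.continuous
  have hD0 : 0 ≤ D := (norm_nonneg _).trans (hD 0)
  have hsub : K ⊆ K' := Metric.self_subset_cthickening K
  -- integration by parts for the mollified functions
  have ibp : ∀ j, ∫ x, f (uj j x) * fderiv ℝ φ x v
      = - ∫ x, f' (uj j x) * mollify volume j g₀ x * φ x := by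
    intro j
    have hd : ∀ x, HasFDerivAt (fun x => f (uj j x)) (f' (uj j x) • fderiv ℝ (uj j) x) x :=
      fun x => (hf _ (huj0 j x)).comp_hasFDerivAt x
        ((hujs j).differentiable (by simp) x).hasFDerivAt
    have hcf : Continuous (fun x => f (uj j x)) :=
      hfc.comp_continuous (hujs j).continuous (huj0 j)
    have hcf' : Continuous (fun x => f' (uj j x)) :=
      hf'c.comp_continuous (hujs j).continuous (huj0 j)
    have hcd : Continuous (fun x => fderiv ℝ (uj j) x v) :=
      ((hujs j).continuous_fderiv (by simp)).clm_apply continuous_const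
    have hcφ : Continuous (fun x => fderiv ℝ φ x v) :=
      (hφ.continuous_fderiv (by simp)).clm_apply continuous_const
    have hdv : ∀ x, fderiv ℝ (fun x => f (uj j x)) x v = f' (uj j x) * fderiv ℝ (uj j) x v := by
      intro x
      rw [(hd x).fderiv]
      rfl
    rw [integral_mul_fderiv_eq_neg_fderiv_mul_of_integrable]
    · congr 1
      refine integral_congr_ae (Eventually.of_forall fun x => ?_)
      by_cases hx : x ∈ K
      · simp only [hdv]
        rw [h.fderiv_mollify j x v]
        congr 2
        refine mollify_congr j fun y hy => ?_
        rw [hg₀, Set.indicator_of_mem]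
        refine Metric.mem_cthickening_of_dist_le y x 1 K hx ?_
        exact (Metric.mem_ball.1 hy).le
      · simp [hφ0 x hx]
    · simp only [hdv]
      exact ((hcf'.mul hcd).mul hφ.continuous).integrable_of_hasCompactSupport hφc.mul_left
    · exact (hcf.mul hcφ).integrable_of_hasCompactSupport (hφc.fderiv_apply ℝ v).mul_left
    · exact (hcf.mul hφ.continuous).integrable_of_hasCompactSupport hφc.mul_left
    · exact fun x _ => (hd x).differentiableAt
    · exact fun x _ => hφ.differentiable (by simp) x
  have hconv : ∀ᵐ x, Tendsto (fun j => uj j x) atTop (𝓝 (u x)) := ae_tendsto_mollify h.1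
  have hlim : ∀ {F : ℝ → ℝ}, ContinuousOn F (Set.Ici 0) → ∀ x,
      Tendsto (fun j => uj j x) atTop (𝓝 (u x)) →
      Tendsto (fun j => F (uj j x)) atTop (𝓝 (F (u x))) := by
    intro F hF x hx
    refine (hF (u x) (hu x)).tendsto.comp ?_
    exact tendsto_nhdsWithin_iff.2 ⟨hx, Eventually.of_forall fun j => huj0 j x⟩
  have L : Tendsto (fun j => ∫ x, f (uj j x) * fderiv ℝ φ x v) atTop
      (𝓝 (∫ x, f (u x) * fderiv ℝ φ x v)) := by
    have hcφ : Continuous (fun x => fderiv ℝ φ x v) :=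
      (hφ.continuous_fderiv (by simp)).clm_apply continuous_const
    refine tendsto_integral_of_dominated_convergence (fun x => C * ‖fderiv ℝ φ x v‖)
      (fun j => ?_) ?_ (fun j => Eventually.of_forall fun x => ?_) ?_
    · exact ((hfc.comp_continuous (hujs j).continuous (huj0 j)).mul hcφ).aestronglyMeasurable
    · exact ((hcφ.integrable_of_hasCompactSupport (hφc.fderiv_apply ℝ v)).norm).const_mul C
    · rw [norm_mul]
      exact mul_le_mul_of_nonneg_right (hfC _ (huj0 j x)) (norm_nonneg _)
    · filter_upwards [hconv] with x hx
      exact (hlim hfc x hx).mul_const _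
  have mf' : ∀ j, AEStronglyMeasurable (fun x => f' (uj j x)) volume := fun j =>
    (hf'c.comp_continuous (hujs j).continuous (huj0 j)).aestronglyMeasurable
  have mf : AEStronglyMeasurable (fun x => f' (u x)) volume :=
    aestronglyMeasurable_comp_of_continuousOn_Ici hf'c hu hum
  have R : Tendsto (fun j => ∫ x, f' (uj j x) * mollify volume j g₀ x * φ x) atTop
      (𝓝 (∫ x, f' (u x) * g₀ x * φ x)) := by
    have hj : ∀ j, Integrable (fun x => f' (uj j x) * (mollify volume j g₀ x - g₀ x) * φ x) := by
      intro j
      refine (((integrable_mollify j hg₀i).sub hg₀i).bdd_mul (c := C) (mf' j) ?_).mul_bdd (c := D)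
        hφ.continuous.aestronglyMeasurable (Eventually.of_forall hD)
      exact Eventually.of_forall fun x => hf'C _ (huj0 j x)
    have hj' : ∀ j, Integrable (fun x => f' (uj j x) * g₀ x * φ x) := by
      intro j
      refine (hg₀i.bdd_mul (c := C) (mf' j) ?_).mul_bdd (c := D)
        hφ.continuous.aestronglyMeasurable (Eventually.of_forall hD)
      exact Eventually.of_forall fun x => hf'C _ (huj0 j x)
    -- The product is split so that `L¹` convergence of the gradients meets the bounded factor `f'
    -- (uj j x)`; the rest is dominated convergence.
    have T1 : Tendsto (fun j => ∫ x, f' (uj j x) * (mollify volume j g₀ x - g₀ x) * φ x) atTop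
        (𝓝 0) := by
      have T := (tendsto_integral_abs_mollify_sub hg₀i).const_mul (C * D)
      rw [mul_zero] at T
      refine squeeze_zero_norm (fun j => ?_) T
      rw [← integral_const_mul]
      refine norm_integral_le_of_norm_le
        (((integrable_mollify j hg₀i).sub hg₀i).abs.const_mul (C * D))
        (Eventually.of_forall fun x => ?_)
      rw [norm_mul, norm_mul]
      calc _ ≤ C * ‖mollify volume j g₀ x - g₀ x‖ * D := by
            gcongr
            · exact hf'C _ (huj0 j x)
            · exact hD x
        _ = _ := by rw [Real.norm_eq_abs]; ring
    have T2 : Tendsto (fun j => ∫ x, f' (uj j x) * g₀ x * φ x) atTop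
        (𝓝 (∫ x, f' (u x) * g₀ x * φ x)) := by
      refine tendsto_integral_of_dominated_convergence (fun x => C * D * |g₀ x|)
        (fun j => (hj' j).aestronglyMeasurable) (hg₀i.abs.const_mul _)
        (fun j => Eventually.of_forall fun x => ?_) ?_
      · rw [norm_mul, norm_mul]
        calc _ ≤ C * ‖g₀ x‖ * D := by
              gcongr
              · exact hf'C _ (huj0 j x)
              · exact hD x
          _ = _ := by rw [Real.norm_eq_abs]; ring
      · filter_upwards [hconv] with x hx
        exact ((hlim hf'c x hx).mul_const _).mul_const _
    have := T1.add T2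
    rw [zero_add] at this
    refine this.congr fun j => ?_
    rw [← integral_add (hj j) (hj' j)]
    congr 1
    funext x
    ring
  have e : ∫ x, f' (u x) * g x * φ x = ∫ x, f' (u x) * g₀ x * φ x := by
    congr 1
    funext x
    by_cases hx : x ∈ K
    · rw [hg₀, Set.indicator_of_mem (hsub hx)]
    · simp [hφ0 x hx]
  rw [e]
  refine tendsto_nhds_unique L ?_
  simp_rw [ibp]
  exact R.neg

/-- Chain rule combined with the Leibniz rule for a smooth cutoff. -/
theorem HasWeakGradient.comp_mul (h : HasWeakGradient u G) (hu : ∀ x, 0 ≤ u x)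
    (hf : ∀ y, 0 ≤ y → HasDerivAt f (f' y) y) (hf'c : ContinuousOn f' (Set.Ici 0))
    (hfC : ∀ y, 0 ≤ y → |f y| ≤ C) (hf'C : ∀ y, 0 ≤ y → |f' y| ≤ C)
    {η : EuclideanSpace ℝ (Fin n) → ℝ} (hη : ContDiff ℝ ∞ η) :
    HasWeakGradient (fun x => f (u x) * η x)
      (fun x => (f' (u x) * η x) • G x + f (u x) • gradient η x) := by
  have hfc : ContinuousOn f (Set.Ici 0) := fun y hy => (hf y hy).continuousAt.continuousWithinAt
  have hum := h.1.aestronglyMeasurable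
  have mf := aestronglyMeasurable_comp_of_continuousOn_Ici hfc hu hum
  have mf' := aestronglyMeasurable_comp_of_continuousOn_Ici hf'c hu hum
  have hgc : Continuous (gradient η) :=
    (InnerProductSpace.toDual ℝ _).symm.continuous.comp (hη.continuous_fderiv (by simp))
  have lf : LocallyIntegrable (fun x => f (u x)) volume := by
    refine (locallyIntegrable_const C).mono mf (Eventually.of_forall fun x => ?_)
    exact (hfC _ (hu x)).trans (le_abs_self C)
  have lf'G : LocallyIntegrable (fun x => f' (u x) • G x) volume := by
    refine (h.2.1.smul C).mono (mf'.smul h.2.1.aestronglyMeasurable)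
      (Eventually.of_forall fun x => ?_)
    simp only [norm_smul, Pi.smul_apply]
    exact mul_le_mul_of_nonneg_right ((hf'C _ (hu x)).trans (le_abs_self C)) (norm_nonneg _)
  have l1 : LocallyIntegrable (fun x => f (u x) * η x) volume := lf.smul_continuous hη.continuous
  have l2 : LocallyIntegrable (fun x => (f' (u x) * η x) • G x) volume := by
    simpa only [smul_smul, mul_comm] using lf'G.continuous_smul hη.continuous
  have l3 : LocallyIntegrable (fun x => f (u x) • gradient η x) volume := lf.smul_continuous hgc
  refine ⟨l1, l2.add l3, ?_⟩
  intro φ hφ hφc v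
  -- Using `η * φ` as the test function moves the Leibniz rule onto smooth functions.
  have h1 := h.integral_comp hu hf hf'c hfC hf'C (hη.mul hφ) hφc.mul_left v
  have hd : ∀ x, fderiv ℝ (fun x => η x * φ x) x v
      = η x * fderiv ℝ φ x v + fderiv ℝ η x v * φ x := by
    intro x
    rw [fderiv_fun_mul (hη.differentiable (by simp) x) (hφ.differentiable (by simp) x)]
    simp [mul_comm]
  have hgr : ∀ x, inner ℝ (gradient η x) v = fderiv ℝ η x v := fun x => by simp [gradient]
  have hcφ : Continuous (fun x => fderiv ℝ φ x v) :=
    (hφ.continuous_fderiv (by simp)).clm_apply continuous_const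
  have hcη : Continuous (fun x => fderiv ℝ η x v) :=
    (hη.continuous_fderiv (by simp)).clm_apply continuous_const
  have i1 : Integrable (fun x => f (u x) * (η x * fderiv ℝ φ x v)) :=
    lf.integrable_smul_right_of_hasCompactSupport (hη.continuous.mul hcφ)
      (hφc.fderiv_apply ℝ v).mul_left
  have i2 : Integrable (fun x => f (u x) * (fderiv ℝ η x v * φ x)) :=
    lf.integrable_smul_right_of_hasCompactSupport (hcη.mul hφ.continuous) hφc.mul_left
  have i3 : Integrable (fun x => f' (u x) * inner ℝ (G x) v * (η x * φ x)) := by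
    have := (lf'G.inner_const_right v).integrable_smul_right_of_hasCompactSupport
      (hη.continuous.mul hφ.continuous) hφc.mul_left
    simpa only [real_inner_smul_left, smul_eq_mul, Pi.mul_apply] using this
  have e1 : (∫ x, f (u x) * η x * fderiv ℝ φ x v) + ∫ x, f (u x) * (fderiv ℝ η x v * φ x)
      = ∫ x, f (u x) * fderiv ℝ (fun x => η x * φ x) x v := by
    simp only [mul_assoc]
    rw [← integral_add i1 i2]
    simp only [hd, mul_add]
  have e2 : ∫ x, inner ℝ ((f' (u x) * η x) • G x + f (u x) • gradient η x) v * φ x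
      = (∫ x, f' (u x) * inner ℝ (G x) v * (η x * φ x))
        + ∫ x, f (u x) * (fderiv ℝ η x v * φ x) := by
    rw [← integral_add i3 i2]
    congr 1
    funext x
    rw [inner_add_left, real_inner_smul_left, real_inner_smul_left, hgr]
    ring
  change ∫ x, f (u x) * η x * fderiv ℝ φ x v
    = -∫ x, inner ℝ ((f' (u x) * η x) • G x + f (u x) • gradient η x) v * φ x
  rw [e2]
  linarith [h1, e1]

end WeakGradient

/-! ### Admissible test functions and the energy inequality. -/

section Energy

variable {n : ℕ}

/-- A nonnegative supersolution with a fixed weak gradient and without exceptional null sets. -/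
structure IsSupersolution (p q s : ℝ) (u : EuclideanSpace ℝ (Fin n) → ℝ)
    (G : EuclideanSpace ℝ (Fin n) → EuclideanSpace ℝ (Fin n)) : Prop where
  nonneg : ∀ x, 0 ≤ u x
  memLpLoc : MemLpLoc u s
  memW1Loc : MemW1Loc p u G
  weak : ∀ (ψ : EuclideanSpace ℝ (Fin n) → ℝ)
        (H : EuclideanSpace ℝ (Fin n) → EuclideanSpace ℝ (Fin n)),
        MemW1 p ψ H → MemLp ψ ∞ volume → HasCompactSupport ψ → (∀ᵐ x, 0 ≤ ψ x) →
          - (∫ x, ‖G x‖ ^ (p - 2) * inner ℝ (G x) (H x))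
            - (∫ x, ‖G x‖ ^ (q - 2) * inner ℝ (G x) (H x))
            + ∫ x, u x ^ s * ψ x ≤ 0

theorem IsNonnegWeakSolution.exists_isSupersolution {p q s : ℝ}
    {u : EuclideanSpace ℝ (Fin n) → ℝ} (h : IsNonnegWeakSolution p q s u) :
    ∃ w G, u =ᵐ[volume] w ∧ IsSupersolution p q s w G := by
  obtain ⟨h0, hs, G, ⟨⟨hu, hG, hw⟩, hup, hGp⟩, hweak⟩ := h
  have e : u =ᵐ[volume] fun x => max (u x) 0 := by
    filter_upwards [h0] with x hx
    rw [max_eq_left hx]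
  refine ⟨fun x => max (u x) 0, G, e, fun x => le_max_right _ _,
    fun K hK => (hs K hK).ae_eq (ae_restrict_of_ae e),
    ⟨⟨hu.congr e, hG, fun φ hφ hφc v => ?_⟩,
      fun K hK => (hup K hK).ae_eq (ae_restrict_of_ae e), hGp⟩, fun ψ H h1 h2 h3 h4 => ?_⟩
  · rw [← hw φ hφ hφc v]
    refine integral_congr_ae ?_
    filter_upwards [e] with x hx
    rw [← hx]
  · have := hweak ψ H h1 h2 h3 h4
    have e2 : ∫ x, (max (u x) 0) ^ s * ψ x = ∫ x, u x ^ s * ψ x := by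
      refine integral_congr_ae ?_
      filter_upwards [e] with x hx
      rw [← hx]
    rwa [e2]

theorem MemLpLoc.integrableOn_norm_rpow {F : Type*} [NormedAddCommGroup F]
    {f : EuclideanSpace ℝ (Fin n) → F} {r r' : ℝ} (hf : MemLpLoc f r) (hr' : 0 ≤ r')
    (hr : r' ≤ r) {K : Set (EuclideanSpace ℝ (Fin n))} (hK : IsCompact K) :
    IntegrableOn (fun x => ‖f x‖ ^ r') K volume := by
  have : IsFiniteMeasure (volume.restrict K) := ⟨by simpa using hK.measure_lt_top⟩
  have h := ((hf K hK).mono_exponent (ENNReal.ofReal_le_ofReal hr)).integrable_norm_rpow'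
  simpa only [ENNReal.toReal_ofReal hr', IntegrableOn] using h

theorem MeasureTheory.IntegrableOn.integrable_mul_of_eq_zero
    {K : Set (EuclideanSpace ℝ (Fin n))} {F w : EuclideanSpace ℝ (Fin n) → ℝ}
    (hF : IntegrableOn F K volume) (hK : IsCompact K) (hw : AEStronglyMeasurable w volume) {C : ℝ}
    (hC : ∀ x, ‖w x‖ ≤ C) (h0 : ∀ x, x ∉ K → w x = 0) :
    Integrable (fun x => F x * w x) volume := by
  refine ((hF.integrable_indicator hK.isClosed.measurableSet).mul_bdd (c := C) hw
    (Eventually.of_forall hC)).congr (Eventually.of_forall fun x => ?_)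
  by_cases hx : x ∈ K
  · simp [hx]
  · simp [h0 x hx]

theorem gradient_eq_zero_of_notMem_tsupport {η : EuclideanSpace ℝ (Fin n) → ℝ}
    {x : EuclideanSpace ℝ (Fin n)} (hx : x ∉ tsupport η) : gradient η x = 0 := by
  have : fderiv ℝ η x = 0 := by
    by_contra h
    exact hx (support_fderiv_subset ℝ (Function.mem_support.2 h))
  simp [gradient, this]

theorem continuous_gradient {η : EuclideanSpace ℝ (Fin n) → ℝ} (hη : ContDiff ℝ ∞ η) :
    Continuous (gradient η) :=
  (InnerProductSpace.toDual ℝ _).symm.continuous.comp (hη.continuous_fderiv (by simp))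

variable {p q s : ℝ} {u : EuclideanSpace ℝ (Fin n) → ℝ}
  {G : EuclideanSpace ℝ (Fin n) → EuclideanSpace ℝ (Fin n)}

namespace IsSupersolution

theorem aemeasurable_add_rpow (h : IsSupersolution p q s u G) (ε r : ℝ) :
    AEStronglyMeasurable (fun x => (u x + ε) ^ r) volume :=
  ((h.memW1Loc.1.1.aestronglyMeasurable.aemeasurable.add_const ε).pow_const r).aestronglyMeasurable

theorem add_rpow_neg_le (h : IsSupersolution p q s u G) {ε r : ℝ} (hε : 0 < ε) (hr : 0 ≤ r)
    (x : EuclideanSpace ℝ (Fin n)) : (u x + ε) ^ (-r) ≤ ε ^ (-r) :=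
  Real.rpow_le_rpow_of_nonpos hε (by linarith [h.nonneg x]) (by linarith)

/-- Integrability of gradient powers against bounded weights. -/
theorem integrable_grad (h : IsSupersolution p q s u G) {r ε a : ℝ} (hr : 0 ≤ r) (hrp : r ≤ p)
    (hε : 0 < ε) (ha : 0 ≤ a) {w : EuclideanSpace ℝ (Fin n) → ℝ} (hw : Continuous w)
    (hwc : HasCompactSupport w) :
    Integrable (fun x => ‖G x‖ ^ r * ((u x + ε) ^ (-a) * w x)) volume := by
  obtain ⟨D, hD⟩ := hwc.exists_bound_of_continuous hw
  refine (h.memW1Loc.2.2.integrableOn_norm_rpow hr hrp hwc).integrable_mul_of_eq_zero hwc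
    (C := ε ^ (-a) * D) ((h.aemeasurable_add_rpow ε (-a)).mul hw.aestronglyMeasurable)
    (fun x => ?_) fun x hx => ?_
  · have h0 : 0 ≤ (u x + ε) ^ (-a) := Real.rpow_nonneg (by linarith [h.nonneg x]) _
    rw [norm_mul, Real.norm_of_nonneg h0]
    exact mul_le_mul (h.add_rpow_neg_le hε ha x) (hD x) (norm_nonneg _) (Real.rpow_nonneg hε.le _)
  · rw [image_eq_zero_of_notMem_tsupport hx, mul_zero]

/-- The shift by `ε` makes `y ↦ (y + ε) ^ (-τ)` and its derivative bounded on `[0, ∞)`, as the chain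
rule requires. -/
theorem memW1_test (h : IsSupersolution p q s u G) {τ ε : ℝ} (hτ : 0 ≤ τ)
    (hε : 0 < ε) {η : EuclideanSpace ℝ (Fin n) → ℝ} (hη : ContDiff ℝ ∞ η)
    (hηc : HasCompactSupport η) :
    MemW1 p (fun x => (u x + ε) ^ (-τ) * η x)
        (fun x => (-τ * (u x + ε) ^ (-τ - 1) * η x) • G x + (u x + ε) ^ (-τ) • gradient η x) ∧
      MemLp (fun x => (u x + ε) ^ (-τ) * η x) ∞ volume := by
  have hpos : ∀ x, 0 < u x + ε := fun x => by linarith [h.nonneg x]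
  obtain ⟨D, hD⟩ := hηc.exists_bound_of_continuous hη.continuous
  have hgr := continuous_gradient hη
  have hgc : HasCompactSupport (gradient η) :=
    HasCompactSupport.intro hηc fun x hx => gradient_eq_zero_of_notMem_tsupport hx
  have mτ := h.aemeasurable_add_rpow ε (-τ)
  have mτ1 := h.aemeasurable_add_rpow ε (-τ - 1)
  have mG := h.memW1Loc.1.2.1.aestronglyMeasurable
  have bτ := h.add_rpow_neg_le hε hτ
  have bτ1 : ∀ x, (u x + ε) ^ (-τ - 1) ≤ ε ^ (-τ - 1) := fun x => by
    have := h.add_rpow_neg_le hε (by linarith : 0 ≤ τ + 1) x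
    rwa [show -(τ + 1) = -τ - 1 by ring] at this
  have i0 : ∀ r : ℝ≥0∞, MemLp (fun x => (u x + ε) ^ (-τ) * η x) r volume := by
    intro r
    refine (hη.continuous.memLp_of_hasCompactSupport (p := r) (μ := volume) hηc).of_le_mul
      (c := ε ^ (-τ)) (mτ.mul hη.continuous.aestronglyMeasurable) (Eventually.of_forall fun x => ?_)
    rw [norm_mul, Real.norm_of_nonneg (Real.rpow_nonneg (hpos x).le _)]
    exact mul_le_mul_of_nonneg_right (bτ x) (norm_nonneg _)
  have i2 : MemLp (fun x => (u x + ε) ^ (-τ) • gradient η x) (ENNReal.ofReal p) volume := by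
    refine (hgr.memLp_of_hasCompactSupport (p := ENNReal.ofReal p) (μ := volume) hgc).of_le_mul
      (c := ε ^ (-τ)) (mτ.smul hgr.aestronglyMeasurable) (Eventually.of_forall fun x => ?_)
    rw [norm_smul, Real.norm_of_nonneg (Real.rpow_nonneg (hpos x).le _)]
    exact mul_le_mul_of_nonneg_right (bτ x) (norm_nonneg _)
  have i1 : MemLp (fun x => (-τ * (u x + ε) ^ (-τ - 1) * η x) • G x) (ENNReal.ofReal p)
      volume := by
    set K := tsupport η
    have hKm : MeasurableSet K := (isClosed_tsupport η).measurableSet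
    have e : (fun x => (-τ * (u x + ε) ^ (-τ - 1) * η x) • G x)
        = K.indicator (fun x => (-τ * (u x + ε) ^ (-τ - 1) * η x) • G x) := by
      funext x
      by_cases hx : x ∈ K
      · simp [hx]
      · simp [hx, image_eq_zero_of_notMem_tsupport hx]
    rw [e, memLp_indicator_iff_restrict hKm]
    refine (h.memW1Loc.2.2 K hηc).of_le_mul (c := τ * ε ^ (-τ - 1) * D) ?_
      (Eventually.of_forall fun x => ?_)
    · exact (((mτ1.const_mul _).mul hη.continuous.aestronglyMeasurable).smul mG).restrict
    · rw [norm_smul, norm_mul, norm_mul, norm_neg, Real.norm_of_nonneg hτ,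
        Real.norm_of_nonneg (Real.rpow_nonneg (hpos x).le _)]
      exact mul_le_mul_of_nonneg_right (mul_le_mul (mul_le_mul_of_nonneg_left (bτ1 x) hτ) (hD x)
        (norm_nonneg _) (by positivity)) (norm_nonneg _)
  refine ⟨⟨?_, i0 _, i1.add i2⟩, i0 _⟩
  have e0 : 0 ≤ ε ^ (-τ) := by positivity
  have e1 : 0 ≤ τ * ε ^ (-τ - 1) := by positivity
  refine h.memW1Loc.1.comp_mul (f := fun y => (y + ε) ^ (-τ))
    (f' := fun y => -τ * (y + ε) ^ (-τ - 1)) (C := ε ^ (-τ) + τ * ε ^ (-τ - 1))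
    h.nonneg (fun y hy => ?_) ?_ (fun y hy => ?_) (fun y hy => ?_) hη
  · have := ((hasDerivAt_id y).add_const ε).rpow_const (p := -τ)
      (Or.inl (by simp only [id]; linarith))
    simpa using this
  · refine continuousOn_const.mul (ContinuousOn.rpow_const (by fun_prop) fun y hy => Or.inl ?_)
    have : 0 ≤ y := hy
    linarith
  · rw [abs_of_nonneg (Real.rpow_nonneg (by linarith) _)]
    have := Real.rpow_le_rpow_of_nonpos hε (by linarith : ε ≤ y + ε) (by linarith : -τ ≤ 0)
    linarith
  · rw [abs_mul, abs_neg, abs_of_nonneg hτ, abs_of_nonneg (Real.rpow_nonneg (by linarith) _)]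
    have := Real.rpow_le_rpow_of_nonpos hε (by linarith : ε ≤ y + ε) (by linarith : -τ - 1 ≤ 0)
    nlinarith

/-- Differentiating the negative power of `u + ε` produces the gradient energy with a favourable
sign; the term with `∇η` is bounded by Cauchy–Schwarz. -/
theorem integral_flux_le (h : IsSupersolution p q s u G) {z τ ε : ℝ} (hz : 1 < z) (hzp : z ≤ p)
    (hτ : 0 ≤ τ) (hε : 0 < ε) {η : EuclideanSpace ℝ (Fin n) → ℝ} (hη : ContDiff ℝ ∞ η)
    (hηc : HasCompactSupport η) :
    ∫ x, ‖G x‖ ^ (z - 2) * inner ℝ (G x)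
        ((-τ * (u x + ε) ^ (-τ - 1) * η x) • G x + (u x + ε) ^ (-τ) • gradient η x)
      ≤ -(τ * ∫ x, ‖G x‖ ^ z * ((u x + ε) ^ (-(τ + 1)) * η x))
        + ∫ x, ‖G x‖ ^ (z - 1) * ((u x + ε) ^ (-τ) * ‖gradient η x‖) := by
  have hpos : ∀ x, 0 < u x + ε := fun x => by linarith [h.nonneg x]
  have hgr := continuous_gradient hη
  have hgc : HasCompactSupport (fun x => ‖gradient η x‖) :=
    HasCompactSupport.intro hηc fun x hx => by simp [gradient_eq_zero_of_notMem_tsupport hx]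
  have mτ := h.aemeasurable_add_rpow ε (-τ)
  have mτ1 := h.aemeasurable_add_rpow ε (-τ - 1)
  have mG := h.memW1Loc.1.2.1.aestronglyMeasurable
  have iA : Integrable (fun x => -(τ * (‖G x‖ ^ z * ((u x + ε) ^ (-(τ + 1)) * η x)))) :=
    ((h.integrable_grad (by linarith) hzp hε (by linarith) hη.continuous hηc).const_mul τ).neg
  have iB := h.integrable_grad (r := z - 1) (by linarith) (by linarith) hε hτ hgr.norm hgc
  have key : ∀ x, ‖G x‖ ^ (z - 2) * inner ℝ (G x)
        ((-τ * (u x + ε) ^ (-τ - 1) * η x) • G x + (u x + ε) ^ (-τ) • gradient η x)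
      = -(τ * (‖G x‖ ^ z * ((u x + ε) ^ (-(τ + 1)) * η x)))
        + ‖G x‖ ^ (z - 2) * ((u x + ε) ^ (-τ) * inner ℝ (G x) (gradient η x)) := by
    intro x
    rw [inner_add_right, inner_smul_right, inner_smul_right, real_inner_self_eq_norm_sq]
    have e : ‖G x‖ ^ z = ‖G x‖ ^ (z - 2) * ‖G x‖ ^ 2 := by
      rcases (norm_nonneg (G x)).eq_or_lt with h0 | h0
      · rw [← h0, Real.zero_rpow (by linarith)]; simp
      · rw [← Real.rpow_natCast, ← Real.rpow_add h0]; congr 1; push_cast; ring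
    rw [e, show -(τ + 1) = -τ - 1 by ring]
    ring
  have bd : ∀ x, |‖G x‖ ^ (z - 2) * ((u x + ε) ^ (-τ) * inner ℝ (G x) (gradient η x))|
      ≤ ‖G x‖ ^ (z - 1) * ((u x + ε) ^ (-τ) * ‖gradient η x‖) := by
    intro x
    have e : ‖G x‖ ^ (z - 1) = ‖G x‖ ^ (z - 2) * ‖G x‖ := by
      rcases (norm_nonneg (G x)).eq_or_lt with h0 | h0
      · rw [← h0, Real.zero_rpow (by linarith)]; simp
      · rw [← Real.rpow_add_one h0.ne']; congr 1; ring
    have hv : 0 ≤ (u x + ε) ^ (-τ) := Real.rpow_nonneg (hpos x).le _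
    rw [abs_mul, abs_mul, abs_of_nonneg hv, abs_of_nonneg (Real.rpow_nonneg (norm_nonneg _) _), e]
    calc _ ≤ ‖G x‖ ^ (z - 2) * ((u x + ε) ^ (-τ) * (‖G x‖ * ‖gradient η x‖)) := by
          gcongr
          exact abs_real_inner_le_norm _ _
      _ = _ := by ring
  have iC : Integrable (fun x =>
      ‖G x‖ ^ (z - 2) * ((u x + ε) ^ (-τ) * inner ℝ (G x) (gradient η x))) := by
    refine iB.mono' ?_ (Eventually.of_forall bd)
    exact (mG.norm.aemeasurable.pow_const _).aestronglyMeasurable.mul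
      (mτ.mul (mG.inner hgr.aestronglyMeasurable))
  simp only [key]
  rw [integral_add iA iC, integral_neg, integral_const_mul]
  exact add_le_add le_rfl <| integral_mono iC iB fun x => (le_abs_self _).trans (bd x)

/-- The weak inequality tested against `(u + ε) ^ (-τ) * η`. -/
theorem energy_le (h : IsSupersolution p q s u G) (hq : 1 < q) (hqp : q ≤ p) {τ ε : ℝ}
    (hτ : 0 ≤ τ) (hε : 0 < ε) {η : EuclideanSpace ℝ (Fin n) → ℝ} (hη : ContDiff ℝ ∞ η)
    (hηc : HasCompactSupport η) (hη0 : ∀ x, 0 ≤ η x) :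
    (∫ x, u x ^ s * ((u x + ε) ^ (-τ) * η x))
        + τ * ((∫ x, ‖G x‖ ^ p * ((u x + ε) ^ (-(τ + 1)) * η x))
          + ∫ x, ‖G x‖ ^ q * ((u x + ε) ^ (-(τ + 1)) * η x))
      ≤ (∫ x, ‖G x‖ ^ (p - 1) * ((u x + ε) ^ (-τ) * ‖gradient η x‖))
        + ∫ x, ‖G x‖ ^ (q - 1) * ((u x + ε) ^ (-τ) * ‖gradient η x‖) := by
  obtain ⟨h1, h2⟩ := h.memW1_test hτ hε hη hηc
  have hw := h.weak _ _ h1 h2 hηc.mul_left (Eventually.of_forall fun x =>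
    mul_nonneg (Real.rpow_nonneg (by linarith [h.nonneg x]) _) (hη0 x))
  have hp' := h.integral_flux_le (hq.trans_le hqp) le_rfl hτ hε hη hηc
  have hq' := h.integral_flux_le hq hqp hτ hε hη hηc
  linarith

end IsSupersolution

end Energy

/-! ### Cutoff functions. -/

/-- `η` is a smooth cutoff between the balls of radii `R` and `2R`, with gradient controlled by
powers of `η` itself. -/
structure IsCutoff {n : ℕ} (k : ℕ) (M R : ℝ) (η : EuclideanSpace ℝ (Fin n) → ℝ) : Prop where
  contDiff : ContDiff ℝ ∞ η
  tsupport_subset : tsupport η ⊆ Metric.closedBall 0 (2 * R)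
  nonneg : ∀ x, 0 ≤ η x
  le_one : ∀ x, η x ≤ 1
  eq_one : ∀ x ∈ Metric.ball 0 R, η x = 1
  norm_gradient_le : ∀ x w, 1 / (k : ℝ) ≤ w → w ≤ 1 → ‖gradient η x‖ ≤ M / R * η x ^ (1 - w)

namespace IsCutoff

variable {n k : ℕ} {M R : ℝ} {η : EuclideanSpace ℝ (Fin n) → ℝ}

theorem hasCompactSupport (h : IsCutoff k M R η) : HasCompactSupport η :=
  (isCompact_closedBall _ _).of_isClosed_subset (isClosed_tsupport η) h.tsupport_subset

theorem gradient_eq_zero (h : IsCutoff k M R η) {x : EuclideanSpace ℝ (Fin n)}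
    (hx : x ∉ Metric.closedBall 0 (2 * R) \ Metric.ball 0 R) : gradient η x = 0 := by
  by_cases h1 : x ∈ Metric.ball 0 R
  · have : η =ᶠ[𝓝 x] fun _ => 1 := by
      filter_upwards [Metric.isOpen_ball.mem_nhds h1] with y hy using h.eq_one y hy
    simp [gradient, this.fderiv_eq]
  · exact gradient_eq_zero_of_notMem_tsupport fun hx' => hx ⟨h.tsupport_subset hx', h1⟩

end IsCutoff

/-- A rescaled bump raised to the power `k` has gradient of order `η ^ (1 - 1/k) / R`. As `0 ≤ η ≤
1`, this controls every exponent `1 - w` with `w ≥ 1/k`, with `M` independent of `R`. -/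
theorem exists_isCutoff (n : ℕ) {k : ℕ} (hk : k ≠ 0) :
    ∃ M : ℝ, 0 ≤ M ∧ ∀ R : ℝ, 0 < R → ∃ η : EuclideanSpace ℝ (Fin n) → ℝ, IsCutoff k M R η := by
  let φ : ContDiffBump (0 : EuclideanSpace ℝ (Fin n)) := ⟨1, 2, one_pos, one_lt_two⟩
  have hφ : ContDiff ℝ ∞ φ := φ.contDiff
  obtain ⟨B, hB⟩ := (φ.hasCompactSupport.fderiv ℝ).exists_bound_of_continuous
    (hφ.continuous_fderiv (by simp))
  have hB0 : 0 ≤ B := (norm_nonneg _).trans (hB 0)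
  refine ⟨k * B, by positivity, fun R hR => ⟨fun x => φ (R⁻¹ • x) ^ k, ?_⟩⟩
  have hk' : (0 : ℝ) < k := by positivity
  have hnorm : ∀ x : EuclideanSpace ℝ (Fin n), ‖R⁻¹ • x‖ = ‖x‖ / R := fun x => by
    rw [norm_smul, norm_inv, Real.norm_of_nonneg hR.le, inv_mul_eq_div]
  refine ⟨(hφ.comp (contDiff_const_smul _)).pow k, ?_, fun x => pow_nonneg φ.nonneg _,
    fun x => pow_le_one₀ φ.nonneg φ.le_one, fun x hx => ?_, fun x w hw hw1 => ?_⟩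
  · refine closure_minimal (fun x hx => ?_) Metric.isClosed_closedBall
    rw [mem_closedBall_zero_iff]
    by_contra hlt
    refine hx ?_
    have : φ (R⁻¹ • x) = 0 := φ.zero_of_le_dist (by
      rw [dist_zero_right, hnorm]
      change 2 ≤ _
      rw [le_div_iff₀ hR]
      exact (not_le.1 hlt).le)
    simp [this, hk]
  · have : φ (R⁻¹ • x) = 1 := φ.one_of_mem_closedBall (by
      rw [mem_closedBall_zero_iff, hnorm]
      change _ ≤ 1
      rw [div_le_one hR]
      exact (mem_ball_zero_iff.1 hx).le)
    simp [this]
  · have hd : HasFDerivAt (fun x => φ (R⁻¹ • x) ^ k)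
        ((k * φ (R⁻¹ • x) ^ (k - 1)) • (R⁻¹ • fderiv ℝ φ (R⁻¹ • x))) x := by
      have h1 : HasFDerivAt (fun x => φ (R⁻¹ • x)) (R⁻¹ • fderiv ℝ φ (R⁻¹ • x)) x := by
        have h2 := (hφ.differentiable (by simp) (R⁻¹ • x)).hasFDerivAt.comp x
          ((hasFDerivAt_id x).const_smul R⁻¹)
        refine h2.congr_fderiv ?_
        ext v
        simp
      simpa using h1.pow k
    have hg : ‖gradient (fun x => φ (R⁻¹ • x) ^ k) x‖
        = k * φ (R⁻¹ • x) ^ (k - 1) * (R⁻¹ * ‖fderiv ℝ φ (R⁻¹ • x)‖) := by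
      rw [gradient, LinearIsometryEquiv.norm_map, hd.fderiv, norm_smul, norm_smul,
        Real.norm_of_nonneg (by have := φ.nonneg (x := R⁻¹ • x); positivity),
        Real.norm_of_nonneg (by positivity)]
    have h0 : 0 ≤ φ (R⁻¹ • x) := φ.nonneg
    have hle : φ (R⁻¹ • x) ^ (k - 1) ≤ (φ (R⁻¹ • x) ^ k) ^ (1 - w) := by
      rw [← Real.rpow_natCast, ← Real.rpow_natCast, ← Real.rpow_mul h0,
        Nat.cast_sub (Nat.one_le_iff_ne_zero.2 hk), Nat.cast_one]
      refine Real.rpow_le_rpow_of_exponent_ge' h0 φ.le_one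
        (mul_nonneg hk'.le (by linarith)) ?_
      have : 1 ≤ w * k := (div_le_iff₀ hk').1 hw
      nlinarith
    rw [hg]
    calc _ ≤ k * (φ (R⁻¹ • x) ^ k) ^ (1 - w) * (R⁻¹ * B) := by
          gcongr
          exact hB _
      _ = _ := by ring

/-! ### Young inequalities for the flux, pointwise and integrated. -/

/-- Weighted Young inequality for the flux term. -/
theorem flux_young {g v e d L a b z s t τ w₁ w₂ w₃ : ℝ} (hg : 0 ≤ g) (hv : 0 < v) (he : 0 ≤ e)
    (hL : 0 ≤ L) (ha : 0 < a) (hb : 0 < b) (hw₁ : 0 ≤ w₁) (hw₂ : 0 ≤ w₂) (hw₃ : 0 < w₃)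
    (hw : w₁ + w₂ + w₃ = 1) (hz : z * w₁ = z - 1) (hs : (s - τ) * w₂ = (t + 1) * w₁ - τ)
    (hd : d ≤ L * e ^ (1 - w₃)) :
    g ^ (z - 1) * (v ^ (-τ) * d) ≤ a * (g ^ z * (v ^ (-(t + 1)) * e)) + b * (v ^ (s - τ) * e)
      + a ^ (-w₁ / w₃) * b ^ (-w₂ / w₃) * L ^ (1 / w₃) := by
  set X := g ^ z * (v ^ (-(t + 1)) * e)
  set Y := v ^ (s - τ) * e
  -- Chosen so that `Z ^ w₃` cancels `a ^ w₁ * b ^ w₂` and leaves the factor `L`.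
  set Z := a ^ (-w₁ / w₃) * b ^ (-w₂ / w₃) * L ^ (1 / w₃)
  have hX : 0 ≤ X := by positivity
  have hY : 0 ≤ Y := by positivity
  have hZ : 0 ≤ Z := by positivity
  have hX1 : (a * X) ^ w₁ = a ^ w₁ * (g ^ (z - 1) * (v ^ (-((t + 1) * w₁)) * e ^ w₁)) := by
    rw [Real.mul_rpow ha.le hX, Real.mul_rpow (by positivity) (by positivity),
      Real.mul_rpow (by positivity) he, ← Real.rpow_mul hg, hz, ← Real.rpow_mul hv.le]
    ring_nf
  have hY1 : (b * Y) ^ w₂ = b ^ w₂ * (v ^ ((t + 1) * w₁ - τ) * e ^ w₂) := by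
    rw [Real.mul_rpow hb.le hY, Real.mul_rpow (by positivity) he, ← Real.rpow_mul hv.le, hs]
  have hZ1 : Z ^ w₃ = a ^ (-w₁) * b ^ (-w₂) * L := by
    rw [Real.mul_rpow (by positivity) (by positivity), Real.mul_rpow (by positivity) (by positivity),
      ← Real.rpow_mul ha.le, ← Real.rpow_mul hb.le, ← Real.rpow_mul hL,
      div_mul_cancel₀ _ hw₃.ne', div_mul_cancel₀ _ hw₃.ne', div_mul_cancel₀ _ hw₃.ne',
      Real.rpow_one]
  have hprod : (a * X) ^ w₁ * (b * Y) ^ w₂ * Z ^ w₃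
      = g ^ (z - 1) * (v ^ (-τ) * (L * e ^ (1 - w₃))) := by
    have e1 : e ^ (1 - w₃) = e ^ w₁ * e ^ w₂ := by
      rw [← Real.rpow_add_of_nonneg he hw₁ hw₂]; congr 1; linarith
    have e2 : v ^ (-τ) = v ^ (-((t + 1) * w₁)) * v ^ ((t + 1) * w₁ - τ) := by
      rw [← Real.rpow_add hv]; congr 1; ring
    have e3 : a ^ w₁ * a ^ (-w₁) = 1 := by rw [← Real.rpow_add ha]; simp
    have e4 : b ^ w₂ * b ^ (-w₂) = 1 := by rw [← Real.rpow_add hb]; simp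
    rw [hX1, hY1, hZ1, e1, e2]
    calc _ = (a ^ w₁ * a ^ (-w₁)) * (b ^ w₂ * b ^ (-w₂)) * (g ^ (z - 1) *
          (v ^ (-((t + 1) * w₁)) * v ^ ((t + 1) * w₁ - τ) * (L * (e ^ w₁ * e ^ w₂)))) := by ring
      _ = _ := by rw [e3, e4]; ring
  have amgm := Real.geom_mean_le_arith_mean3_weighted hw₁ hw₂ hw₃.le (mul_nonneg ha.le hX)
    (mul_nonneg hb.le hY) hZ hw
  have haX := mul_nonneg ha.le hX
  have hbY := mul_nonneg hb.le hY
  calc g ^ (z - 1) * (v ^ (-τ) * d) ≤ g ^ (z - 1) * (v ^ (-τ) * (L * e ^ (1 - w₃))) := by gcongr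
    _ = (a * X) ^ w₁ * (b * Y) ^ w₂ * Z ^ w₃ := hprod.symm
    _ ≤ w₁ * (a * X) + w₂ * (b * Y) + w₃ * Z := amgm
    _ ≤ 1 * (a * X) + 1 * (b * Y) + 1 * Z := by gcongr <;> linarith
    _ = _ := by ring

theorem add_rpow_le_two_rpow_mul {y ε s : ℝ} (hy : 0 ≤ y) (hε : 0 ≤ ε) (hs : 0 ≤ s) :
    (y + ε) ^ s ≤ 2 ^ s * (y ^ s + ε ^ s) := by
  have h1 : (y + ε) ^ s ≤ (2 * max y ε) ^ s :=
    Real.rpow_le_rpow (by positivity) (by linarith [le_max_left y ε, le_max_right y ε]) hs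
  rw [Real.mul_rpow (by norm_num) (le_max_of_le_left hy)] at h1
  refine h1.trans (mul_le_mul_of_nonneg_left ?_ (by positivity))
  have h2 := Real.rpow_nonneg hy s
  have h3 := Real.rpow_nonneg hε s
  rcases max_choice y ε with h | h <;> rw [h] <;> linarith

/-- Young's inequality yields powers of `u + ε`, whereas the source carries `u ^ s`; the discrepancy
costs a factor `2 ^ s` and an error that vanishes with `ε` when `τ < s`. -/
theorem add_rpow_sub_le {y ε s τ : ℝ} (hy : 0 ≤ y) (hε : 0 < ε) (hs : 0 ≤ s) (hτ : 0 ≤ τ) :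
    (y + ε) ^ (s - τ) ≤ 2 ^ s * (y ^ s * (y + ε) ^ (-τ) + ε ^ (s - τ)) := by
  have hv : 0 < y + ε := by linarith
  have h1 : (y + ε) ^ (-τ) ≤ ε ^ (-τ) :=
    Real.rpow_le_rpow_of_nonpos hε (by linarith) (by linarith)
  rw [sub_eq_add_neg, Real.rpow_add hv, Real.rpow_add hε]
  calc _ ≤ 2 ^ s * (y ^ s + ε ^ s) * (y + ε) ^ (-τ) := by
        gcongr
        exact add_rpow_le_two_rpow_mul hy hε.le hs
    _ = 2 ^ s * (y ^ s * (y + ε) ^ (-τ) + ε ^ s * (y + ε) ^ (-τ)) := by ring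
    _ ≤ _ := by gcongr

namespace IsSupersolution

variable {n : ℕ} {p q s : ℝ} {u : EuclideanSpace ℝ (Fin n) → ℝ}
  {G : EuclideanSpace ℝ (Fin n) → EuclideanSpace ℝ (Fin n)}

theorem integrable_source (h : IsSupersolution p q s u G) (hs : 0 ≤ s) {τ ε : ℝ} (hτ : 0 ≤ τ)
    (hε : 0 < ε) {w : EuclideanSpace ℝ (Fin n) → ℝ} (hw : Continuous w)
    (hwc : HasCompactSupport w) :
    Integrable (fun x => u x ^ s * ((u x + ε) ^ (-τ) * w x)) volume := by
  obtain ⟨D, hD⟩ := hwc.exists_bound_of_continuous hw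
  have hu := h.memLpLoc.integrableOn_norm_rpow hs le_rfl hwc
  simp only [Real.norm_of_nonneg (h.nonneg _)] at hu
  refine hu.integrable_mul_of_eq_zero hwc
    (C := ε ^ (-τ) * D) ((h.aemeasurable_add_rpow ε (-τ)).mul hw.aestronglyMeasurable)
    (fun x => ?_) fun x hx => ?_
  · have h0 : 0 ≤ (u x + ε) ^ (-τ) := Real.rpow_nonneg (by linarith [h.nonneg x]) _
    rw [norm_mul, Real.norm_of_nonneg h0]
    exact mul_le_mul (h.add_rpow_neg_le hε hτ x) (hD x) (norm_nonneg _) (Real.rpow_nonneg hε.le _)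
  · rw [image_eq_zero_of_notMem_tsupport hx, mul_zero]

/-- Off the annulus `∇η = 0`, so `flux_young` is needed only there. Confining the source term to the
annulus is essential for the final limit; the constant terms are integrated over the larger ball. -/
theorem integral_flux_young (h : IsSupersolution p q s u G) (hs : 0 ≤ s)
    {k : ℕ} {M R : ℝ} {η : EuclideanSpace ℝ (Fin n) → ℝ} (hη : IsCutoff k M R η) (hM : 0 ≤ M)
    (hR : 0 < R) {a b z t τ ε w₁ w₂ w₃ : ℝ} (hzp : z ≤ p) (hz1 : 1 < z) (ht : 0 ≤ t) (hτ : 0 ≤ τ)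
    (hε : 0 < ε) (ha : 0 < a) (hb : 0 < b) (hw₁ : 0 ≤ w₁) (hw₂ : 0 ≤ w₂) (hw₃ : 0 < w₃)
    (hw : w₁ + w₂ + w₃ = 1) (hz : z * w₁ = z - 1) (hsτ : (s - τ) * w₂ = (t + 1) * w₁ - τ)
    (hk : 1 / (k : ℝ) ≤ w₃) :
    ∫ x, ‖G x‖ ^ (z - 1) * ((u x + ε) ^ (-τ) * ‖gradient η x‖)
      ≤ a * (∫ x, ‖G x‖ ^ z * ((u x + ε) ^ (-(t + 1)) * η x))
        + b * 2 ^ s * (∫ x in Metric.closedBall 0 (2 * R) \ Metric.ball 0 R,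
            u x ^ s * ((u x + ε) ^ (-τ) * η x))
        + (b * 2 ^ s * ε ^ (s - τ)
            + a ^ (-w₁ / w₃) * b ^ (-w₂ / w₃) * (M / R) ^ (1 / w₃))
          * volume.real (Metric.closedBall (0 : EuclideanSpace ℝ (Fin n)) (2 * R)) := by
  set B := Metric.closedBall (0 : EuclideanSpace ℝ (Fin n)) (2 * R)
  set A := B \ Metric.ball 0 R with hA
  have hBm : MeasurableSet B := measurableSet_closedBall
  have hAm : MeasurableSet A := hBm.diff measurableSet_ball
  set c := b * 2 ^ s * ε ^ (s - τ) + a ^ (-w₁ / w₃) * b ^ (-w₂ / w₃) * (M / R) ^ (1 / w₃) with hc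
  have hL : 0 ≤ M / R := by positivity
  have hc0 : 0 ≤ c := by positivity
  have hηc := hη.contDiff.continuous
  have hgr := continuous_gradient hη.contDiff
  have hgc : HasCompactSupport (fun x => ‖gradient η x‖) :=
    HasCompactSupport.intro hη.hasCompactSupport fun x hx => by
      simp [gradient_eq_zero_of_notMem_tsupport hx]
  have i0 := h.integrable_grad (r := z - 1) (by linarith) (by linarith) hε hτ hgr.norm hgc
  have i1 := (h.integrable_grad (r := z) (a := t + 1) (by linarith) hzp hε (by linarith) hηc
    hη.hasCompactSupport).const_mul a
  have i2 := ((h.integrable_source hs hτ hε hηc hη.hasCompactSupport).indicator hAm).const_mul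
    (b * 2 ^ s)
  have i12 : Integrable (fun x => a * (‖G x‖ ^ z * ((u x + ε) ^ (-(t + 1)) * η x))
      + b * 2 ^ s * A.indicator (fun x => u x ^ s * ((u x + ε) ^ (-τ) * η x)) x) volume := i1.add i2
  have i3 : Integrable (B.indicator fun _ => c) volume :=
    (integrable_indicator_iff hBm).2 (integrableOn_const (isCompact_closedBall _ _).measure_ne_top)
  have e2 : ∫ x in A, u x ^ s * ((u x + ε) ^ (-τ) * η x)
      = ∫ x, A.indicator (fun x => u x ^ s * ((u x + ε) ^ (-τ) * η x)) x :=
    (integral_indicator hAm).symm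
  have e3 : c * volume.real B = ∫ x, B.indicator (fun _ => c) x := by
    rw [integral_indicator hBm, setIntegral_const, smul_eq_mul, mul_comm]
  rw [e2, e3, ← integral_const_mul, ← integral_const_mul, ← integral_add i1 i2,
    ← integral_add i12 i3]
  refine integral_mono i0 (i12.add i3) fun x => ?_
  have hu := h.nonneg x
  have hv : 0 < u x + ε := by linarith
  have he := hη.nonneg x
  by_cases hx : x ∈ A
  · simp only [Set.indicator_of_mem hx, Set.indicator_of_mem hx.1]
    have y := flux_young (norm_nonneg (G x)) hv he hL ha hb hw₁ hw₂ hw₃ hw hz hsτ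
      (hη.norm_gradient_le x w₃ hk (by linarith))
    refine y.trans ?_
    have h1 : (u x + ε) ^ (s - τ) * η x
        ≤ 2 ^ s * (u x ^ s * ((u x + ε) ^ (-τ) * η x)) + 2 ^ s * ε ^ (s - τ) := by
      calc _ ≤ 2 ^ s * (u x ^ s * (u x + ε) ^ (-τ) + ε ^ (s - τ)) * η x := by
            gcongr
            exact add_rpow_sub_le hu hε hs hτ
        _ = 2 ^ s * (u x ^ s * ((u x + ε) ^ (-τ) * η x)) + 2 ^ s * ε ^ (s - τ) * η x := by ring
        _ ≤ _ := by
            exact add_le_add le_rfl (mul_le_of_le_one_right (by positivity) (hη.le_one x))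
    have h2 := mul_le_mul_of_nonneg_left h1 hb.le
    rw [hc]
    linarith
  · simp only [Set.indicator_of_notMem hx, hη.gradient_eq_zero hx, norm_zero,
      mul_zero]
    have : 0 ≤ B.indicator (fun _ => c) x := Set.indicator_nonneg (fun _ _ => hc0) x
    positivity

end IsSupersolution

/-! ### A priori estimates on large balls. -/

theorem volume_real_closedBall_eq (n : ℕ) {R : ℝ} (hR : 0 ≤ R) :
    volume.real (Metric.closedBall (0 : EuclideanSpace ℝ (Fin n)) (2 * R))
      = 2 ^ n * volume.real (Metric.ball (0 : EuclideanSpace ℝ (Fin n)) 1) * R ^ (n : ℝ) := by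
  rw [Measure.addHaar_real_closedBall _ _ (by positivity), finrank_euclideanSpace_fin, mul_pow,
    Real.rpow_natCast]
  ring

theorem div_rpow_mul_rpow_le {M R r e : ℝ} {m : ℝ} (hM : 0 ≤ M) (hR : 1 ≤ R) (h : m - r ≤ e) :
    (M / R) ^ r * R ^ m ≤ M ^ r * R ^ e := by
  have hR0 : 0 < R := by linarith
  rw [Real.div_rpow hM hR0.le, div_mul_eq_mul_div, mul_div_assoc, ← Real.rpow_sub hR0]
  exact mul_le_mul_of_nonneg_left (Real.rpow_le_rpow_of_exponent_le hR h) (by positivity)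

namespace IsSupersolution

variable {n : ℕ} {p q s : ℝ} {u : EuclideanSpace ℝ (Fin n) → ℝ}
  {G : EuclideanSpace ℝ (Fin n) → EuclideanSpace ℝ (Fin n)}

theorem setIntegral_source_le (h : IsSupersolution p q s u G) (hs : 0 ≤ s) {τ ε : ℝ} (hτ : 0 ≤ τ)
    (hε : 0 < ε) {k : ℕ} {M R : ℝ} {η : EuclideanSpace ℝ (Fin n) → ℝ} (hη : IsCutoff k M R η)
    (A : Set (EuclideanSpace ℝ (Fin n))) :
    ∫ x in A, u x ^ s * ((u x + ε) ^ (-τ) * η x) ≤ ∫ x, u x ^ s * ((u x + ε) ^ (-τ) * η x) :=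
  setIntegral_le_integral (h.integrable_source hs hτ hε hη.contDiff.continuous hη.hasCompactSupport)
    (Eventually.of_forall fun x => mul_nonneg (Real.rpow_nonneg (h.nonneg x) _)
      (mul_nonneg (Real.rpow_nonneg (by linarith [h.nonneg x]) _) (hη.nonneg x)))

/-- This is the case `τ = t` of the flux estimate, where the Young weights are forced by
homogeneity; `t ≤ z - 1` makes `w₂` nonnegative. The coefficients `t / 2` and `1 / 4` leave room to
absorb the fluxes for both `p` and `q`. -/
theorem exists_weighted_flux_le (h : IsSupersolution p q s u G) {z t : ℝ} (hz : 1 < z)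
    (hzp : z ≤ p) (hzs : z - 1 < s) (hcrit : n * (s - z + 1) ≤ z * s) (ht : 0 < t)
    (htz : t ≤ z - 1) {k : ℕ} (hk : 1 / (k : ℝ) ≤ (s - z + 1) / (z * (s - t))) {M : ℝ}
    (hM : 0 ≤ M) :
    ∃ D : ℝ, 0 ≤ D ∧ ∀ (R : ℝ) (η : EuclideanSpace ℝ (Fin n) → ℝ) (ε : ℝ), 1 ≤ R →
      IsCutoff k M R η → 0 < ε →
      ∫ x, ‖G x‖ ^ (z - 1) * ((u x + ε) ^ (-t) * ‖gradient η x‖)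
        ≤ t / 2 * (∫ x, ‖G x‖ ^ z * ((u x + ε) ^ (-(t + 1)) * η x))
          + 1 / 4 * (∫ x, u x ^ s * ((u x + ε) ^ (-t) * η x))
          + D * (R ^ (n * t / s) + ε ^ (s - t) * R ^ (n : ℝ)) := by
  have hst : 0 < s - t := by linarith
  have hs : 0 < s := by linarith
  have hz0 : 0 < z := by linarith
  set w₁ := (z - 1) / z with hw₁
  set w₂ := (z - 1 - t) / (z * (s - t)) with hw₂
  set w₃ := (s - z + 1) / (z * (s - t)) with hw₃
  have h1 : 0 ≤ w₁ := div_nonneg (by linarith) hz0.le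
  have h2 : 0 ≤ w₂ := div_nonneg (by linarith) (by positivity)
  have h3 : 0 < w₃ := div_pos (by linarith) (by positivity)
  have hsum : w₁ + w₂ + w₃ = 1 := by
    rw [hw₁, hw₂, hw₃]; field_simp; ring
  have hzw : z * w₁ = z - 1 := by rw [hw₁]; field_simp
  have hsw : (s - t) * w₂ = (t + 1) * w₁ - t := by
    rw [hw₁, hw₂]; field_simp; ring
  -- Since `s - t > 0`, this is equivalent to the criticality condition `n (s - z + 1) ≤ z s`.
  have hexp : (n : ℝ) - 1 / w₃ ≤ n * t / s := by
    have h31 : 0 < s - z + 1 := by linarith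
    have e : (n : ℝ) - 1 / w₃ - n * t / s
        = (n * (s - z + 1) - z * s) * ((s - t) / (s * (s - z + 1))) := by
      rw [hw₃]; field_simp; ring
    have : (n * (s - z + 1) - z * s) * ((s - t) / (s * (s - z + 1))) ≤ 0 :=
      mul_nonpos_of_nonpos_of_nonneg (by linarith) (by positivity)
    linarith
  set κ := 2 ^ n * volume.real (Metric.ball (0 : EuclideanSpace ℝ (Fin n)) 1)
  have hκ : 0 ≤ κ := by positivity
  have hb : (0 : ℝ) < 1 / 4 * (2 ^ s)⁻¹ := by positivity
  have hb2 : 1 / 4 * (2 ^ s)⁻¹ * 2 ^ s = (1 / 4 : ℝ) := by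
    rw [mul_assoc, inv_mul_cancel₀ (by positivity), mul_one]
  set Γ := (t / 2) ^ (-w₁ / w₃) * (1 / 4 * (2 ^ s)⁻¹ : ℝ) ^ (-w₂ / w₃)
  have hΓ : 0 ≤ Γ := by positivity
  have hMw : 0 ≤ M ^ (1 / w₃) := by positivity
  refine ⟨κ * (1 / 4) + Γ * κ * M ^ (1 / w₃), by positivity, fun R η ε hR hη hε => ?_⟩
  have hR0 : 0 < R := by linarith
  have y := h.integral_flux_young hs.le hη hM hR0 hzp hz ht.le ht.le hε (half_pos ht) hb h1 h2 h3
    hsum hzw hsw hk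
  rw [hb2, volume_real_closedBall_eq n hR0.le] at y
  have hA := h.setIntegral_source_le hs.le ht.le hε hη
    (Metric.closedBall 0 (2 * R) \ Metric.ball 0 R)
  have hpow := mul_le_mul_of_nonneg_left (div_rpow_mul_rpow_le hM hR hexp) (mul_nonneg hΓ hκ)
  have hRn : 0 ≤ R ^ (n : ℝ) := by positivity
  have hRs : 0 ≤ R ^ (n * t / s) := by positivity
  have hεs : 0 ≤ ε ^ (s - t) := by positivity
  have t1 : 0 ≤ κ * R ^ (n * t / s) := by positivity
  have t2 : 0 ≤ Γ * κ * M ^ (1 / w₃) * (ε ^ (s - t) * R ^ (n : ℝ)) := by positivity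
  refine y.trans ?_
  calc _ ≤ t / 2 * (∫ x, ‖G x‖ ^ z * ((u x + ε) ^ (-(t + 1)) * η x))
          + 1 / 4 * (∫ x, u x ^ s * ((u x + ε) ^ (-t) * η x))
          + (κ * (1 / 4) * (ε ^ (s - t) * R ^ (n : ℝ))
            + Γ * κ * ((M / R) ^ (1 / w₃) * R ^ (n : ℝ))) := by
        have := mul_le_mul_of_nonneg_left hA (by norm_num : (0 : ℝ) ≤ 1 / 4)
        linarith
    _ ≤ _ := by linarith

/-- Weighted gradient estimate on balls. -/
theorem exists_integral_grad_le (h : IsSupersolution p q s u G) {t : ℝ} (hq : 1 < q)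
    (hqp : q ≤ p) (hps : p - 1 < s) (hcritp : n * (s - p + 1) ≤ p * s)
    (hcritq : n * (s - q + 1) ≤ q * s) (ht : 0 < t) (htq : t ≤ q - 1)
    {k : ℕ} (hkp : 1 / (k : ℝ) ≤ (s - p + 1) / (p * (s - t)))
    (hkq : 1 / (k : ℝ) ≤ (s - q + 1) / (q * (s - t))) {M : ℝ} (hM : 0 ≤ M) :
    ∃ D : ℝ, 0 ≤ D ∧ ∀ (R : ℝ) (η : EuclideanSpace ℝ (Fin n) → ℝ) (ε : ℝ), 1 ≤ R →
      IsCutoff k M R η → 0 < ε →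
      (∫ x, ‖G x‖ ^ p * ((u x + ε) ^ (-(t + 1)) * η x))
        + (∫ x, ‖G x‖ ^ q * ((u x + ε) ^ (-(t + 1)) * η x))
          ≤ D * (R ^ (n * t / s) + ε ^ (s - t) * R ^ (n : ℝ)) := by
  obtain ⟨D₁, hD₁, H₁⟩ := h.exists_weighted_flux_le (hq.trans_le hqp) le_rfl hps hcritp ht
    (by linarith) hkp hM
  obtain ⟨D₂, hD₂, H₂⟩ := h.exists_weighted_flux_le hq hqp (by linarith) hcritq ht htq hkq hM
  refine ⟨2 / t * (D₁ + D₂), by positivity, fun R η ε hR hη hε => ?_⟩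
  have y₁ := H₁ R η ε hR hη hε
  have y₂ := H₂ R η ε hR hη hε
  have y := h.energy_le hq hqp ht.le hε hη.contDiff hη.hasCompactSupport hη.nonneg
  have hS : 0 ≤ ∫ x, u x ^ s * ((u x + ε) ^ (-t) * η x) :=
    integral_nonneg fun x => mul_nonneg (Real.rpow_nonneg (h.nonneg x) _)
      (mul_nonneg (Real.rpow_nonneg (by linarith [h.nonneg x]) _) (hη.nonneg x))
  rw [div_mul_eq_mul_div, div_mul_eq_mul_div, le_div_iff₀ ht]
  linarith

/-- The unweighted flux (`τ = 0`) is still compared with the energy of weight `-(t + 1)`, for which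
a bound is available. Positivity of the third Young weight is the condition `(t + 1) (z - 1) < s`.
-/
theorem integral_flux_le_of_grad_le (h : IsSupersolution p q s u G) {z t : ℝ} (hz : 1 < z)
    (hzp : z ≤ p) (hs : 0 < s) (hcrit : n * (s - z + 1) ≤ z * s) (ht : 0 < t)
    (htz : (t + 1) * (z - 1) < s)
    {k : ℕ} (hk : 1 / (k : ℝ) ≤ (s - (t + 1) * (z - 1)) / (z * s)) {M : ℝ}
    (hM : 0 ≤ M) {D : ℝ}
    (hD : ∀ (R : ℝ) (η : EuclideanSpace ℝ (Fin n) → ℝ) (ε : ℝ), 1 ≤ R →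
      IsCutoff k M R η → 0 < ε →
      ∫ x, ‖G x‖ ^ z * ((u x + ε) ^ (-(t + 1)) * η x)
        ≤ D * (R ^ (n * t / s) + ε ^ (s - t) * R ^ (n : ℝ))) :
    ∃ C c₁ c₂ : ℝ, 0 ≤ C ∧ 0 < c₂ ∧ ∀ (a b R : ℝ) (η : EuclideanSpace ℝ (Fin n) → ℝ) (ε : ℝ),
      0 < a → 0 < b → 1 ≤ R → IsCutoff k M R η → 0 < ε →
      ∫ x, ‖G x‖ ^ (z - 1) * ((u x + ε) ^ (-(0 : ℝ)) * ‖gradient η x‖)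
        ≤ a * D * (1 + ε ^ (s - t) * R ^ (n - n * t / s))
          + b * 2 ^ s * (∫ x in Metric.closedBall 0 (2 * R) \ Metric.ball 0 R, u x ^ s * η x)
          + b * C * (ε ^ s * R ^ (n : ℝ)) + C * (a ^ c₁ * b ^ (-c₂)) := by
  have hz0 : 0 < z := by linarith
  set w₁ := (z - 1) / z with hw₁
  set w₂ := (t + 1) * (z - 1) / (z * s) with hw₂
  set w₃ := (s - (t + 1) * (z - 1)) / (z * s) with hw₃
  have hz1 : 0 < z - 1 := by linarith
  have h1 : 0 ≤ w₁ := by positivity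
  have h2 : 0 < w₂ := by positivity
  have h3 : 0 < w₃ := div_pos (by linarith) (by positivity)
  have hsum : w₁ + w₂ + w₃ = 1 := by
    rw [hw₁, hw₂, hw₃]; field_simp; ring
  have hzw : z * w₁ = z - 1 := by rw [hw₁]; field_simp
  have hsw : (s - 0) * w₂ = (t + 1) * w₁ - 0 := by
    rw [hw₁, hw₂]; field_simp; ring
  set σ := n * t / s with hσ
  -- After multiplication by `w₃` the terms containing `t` cancel and criticality alone remains.
  have hexp : (n : ℝ) - 1 / w₃ ≤ -(σ * (w₁ / w₃)) := by
    have e : (n : ℝ) * w₃ - 1 + σ * w₁ = (n * (s - z + 1) - z * s) / (z * s) := by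
      rw [hw₁, hw₃, hσ]; field_simp; ring
    have hle : (n : ℝ) * w₃ - 1 + σ * w₁ ≤ 0 := by
      rw [e]; exact div_nonpos_of_nonpos_of_nonneg (by linarith) (by positivity)
    have e2 : (n : ℝ) - 1 / w₃ + σ * (w₁ / w₃) = ((n : ℝ) * w₃ - 1 + σ * w₁) / w₃ := by
      field_simp
    have := div_nonpos_of_nonpos_of_nonneg hle h3.le
    linarith
  set κ := 2 ^ n * volume.real (Metric.ball (0 : EuclideanSpace ℝ (Fin n)) 1)
  have hκ : 0 ≤ κ := by positivity
  have hMw : 0 ≤ M ^ (1 / w₃) := by positivity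
  refine ⟨κ * 2 ^ s + κ * M ^ (1 / w₃), -w₁ / w₃, w₂ / w₃, by positivity, by positivity,
    fun a b R η ε ha hb hR hη hε => ?_⟩
  have hR0 : 0 < R := by linarith
  -- The energy coefficient `a * R ^ (-σ)` offsets the growth `R ^ σ` of the energy; the resulting
  -- loss in the third Young term is paid for by `hexp`.
  have ha' : 0 < a * R ^ (-σ) := by positivity
  have y := h.integral_flux_young hs.le hη hM hR0 hzp hz ht.le le_rfl hε ha' hb h1 h2.le h3
    hsum hzw hsw hk
  rw [volume_real_closedBall_eq n hR0.le] at y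
  have hX : a * R ^ (-σ) * (∫ x, ‖G x‖ ^ z * ((u x + ε) ^ (-(t + 1)) * η x))
      ≤ a * D * (1 + ε ^ (s - t) * R ^ (n - σ)) := by
    calc _ ≤ a * R ^ (-σ) * (D * (R ^ σ + ε ^ (s - t) * R ^ (n : ℝ))) :=
          mul_le_mul_of_nonneg_left (hD R η ε hR hη hε) ha'.le
      _ = a * D * (R ^ (-σ) * R ^ σ + ε ^ (s - t) * (R ^ (n : ℝ) * R ^ (-σ))) := by ring
      _ = _ := by
        rw [← Real.rpow_add hR0, ← Real.rpow_add hR0, neg_add_cancel, Real.rpow_zero,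
          sub_eq_add_neg (n : ℝ) σ]
  have hpow := div_rpow_mul_rpow_le hM hR hexp
  have hZ : (a * R ^ (-σ)) ^ (-w₁ / w₃) * b ^ (-w₂ / w₃) * (M / R) ^ (1 / w₃) * (κ * R ^ (n : ℝ))
      ≤ κ * M ^ (1 / w₃) * (a ^ (-w₁ / w₃) * b ^ (-(w₂ / w₃))) := by
    have e1 : (a * R ^ (-σ)) ^ (-w₁ / w₃) = a ^ (-w₁ / w₃) * R ^ (σ * (w₁ / w₃)) := by
      rw [Real.mul_rpow ha.le (by positivity), ← Real.rpow_mul hR0.le]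
      congr 2
      ring
    have e2 : R ^ (σ * (w₁ / w₃)) * R ^ (-(σ * (w₁ / w₃))) = 1 := by
      rw [← Real.rpow_add hR0, add_neg_cancel, Real.rpow_zero]
    rw [e1, neg_div w₃ w₂]
    calc _ = κ * (a ^ (-w₁ / w₃) * b ^ (-(w₂ / w₃))) * R ^ (σ * (w₁ / w₃))
          * ((M / R) ^ (1 / w₃) * R ^ (n : ℝ)) := by ring
      _ ≤ κ * (a ^ (-w₁ / w₃) * b ^ (-(w₂ / w₃))) * R ^ (σ * (w₁ / w₃))
          * (M ^ (1 / w₃) * R ^ (-(σ * (w₁ / w₃)))) := by gcongr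
      _ = κ * M ^ (1 / w₃) * (a ^ (-w₁ / w₃) * b ^ (-(w₂ / w₃)))
          * (R ^ (σ * (w₁ / w₃)) * R ^ (-(σ * (w₁ / w₃)))) := by ring
      _ = _ := by rw [e2, mul_one]
  have t1 : 0 ≤ κ * 2 ^ s * (a ^ (-w₁ / w₃) * b ^ (-(w₂ / w₃))) := by positivity
  have t2 : 0 ≤ b * (κ * M ^ (1 / w₃)) * (ε ^ s * R ^ (n : ℝ)) := by positivity
  simp only [neg_zero, Real.rpow_zero, one_mul, sub_zero] at y ⊢
  linarith

/-- Self-improving estimate for the source term on annuli. -/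
theorem exists_integral_source_le (h : IsSupersolution p q s u G) (hq : 1 < q)
    (hqp : q ≤ p) (hps : p - 1 < s) (hcritp : n * (s - p + 1) ≤ p * s)
    (hcritq : n * (s - q + 1) ≤ q * s) :
    ∃ (k : ℕ) (M C c₁ c₂ c₃ c₄ : ℝ), 0 ≤ C ∧ 0 < c₂ ∧ 0 < c₄ ∧
      (∀ R : ℝ, 0 < R → ∃ η : EuclideanSpace ℝ (Fin n) → ℝ, IsCutoff k M R η) ∧
      ∀ (a b R : ℝ) (η : EuclideanSpace ℝ (Fin n) → ℝ),
      0 < a → 0 < b → 1 ≤ R → IsCutoff k M R η →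
      ∫ x, u x ^ s * η x
        ≤ C * a + C * b * (∫ x in Metric.closedBall 0 (2 * R) \ Metric.ball 0 R, u x ^ s * η x)
          + C * (a ^ c₁ * b ^ (-c₂) + a ^ c₃ * b ^ (-c₄)) := by
  have hs : 0 < s := by linarith
  -- Such a `t` exists because `q > 1` and `s > p - 1`.
  obtain ⟨t, ht, htq, htp⟩ : ∃ t : ℝ, 0 < t ∧ t ≤ q - 1 ∧ (t + 1) * (p - 1) < s := by
    refine ⟨min (q - 1) ((s - (p - 1)) / (2 * (p - 1))), ?_, min_le_left _ _, ?_⟩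
    · exact lt_min (by linarith) (div_pos (by linarith) (by linarith))
    · have h1 := min_le_right (q - 1) ((s - (p - 1)) / (2 * (p - 1)))
      rw [le_div_iff₀ (by linarith)] at h1
      linarith
  have hq1 : 0 < q - 1 := by linarith
  have htq2 : (t + 1) * (q - 1) < s :=
    lt_of_le_of_lt (mul_le_mul_of_nonneg_left (by linarith) (by linarith)) htp
  have hst : 0 < s - t := by linarith
  -- The smallest of the four third Young weights; one cutoff power `k` with `1 / k ≤ r` serves all
  -- of them.
  set r := min (min ((s - p + 1) / (p * (s - t))) ((s - q + 1) / (q * (s - t))))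
    (min ((s - (t + 1) * (p - 1)) / (p * s)) ((s - (t + 1) * (q - 1)) / (q * s))) with hr
  have hp0 : 0 < p := by linarith
  have hq0 : 0 < q := by linarith
  have hr0 : 0 < r := by
    refine lt_min (lt_min ?_ ?_) (lt_min ?_ ?_) <;> apply div_pos <;> first | positivity | linarith
  obtain ⟨m, hm⟩ := exists_nat_one_div_lt hr0
  have hk : 1 / ((m + 1 : ℕ) : ℝ) ≤ r := by exact_mod_cast hm.le
  obtain ⟨M, hM, hcut⟩ := exists_isCutoff n (Nat.succ_ne_zero m)
  obtain ⟨D, hD0, hD⟩ := h.exists_integral_grad_le hq hqp hps hcritp hcritq ht htq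
    (hk.trans ((min_le_left _ _).trans (min_le_left _ _)))
    (hk.trans ((min_le_left _ _).trans (min_le_right _ _))) hM
  have hX : ∀ (z : ℝ) (R : ℝ) (η : EuclideanSpace ℝ (Fin n) → ℝ) (ε : ℝ), IsCutoff (m + 1) M R η →
      0 < ε → 0 ≤ ∫ x, ‖G x‖ ^ z * ((u x + ε) ^ (-(t + 1)) * η x) := fun z R η ε hη hε =>
    integral_nonneg fun x => mul_nonneg (Real.rpow_nonneg (norm_nonneg _) _)
      (mul_nonneg (Real.rpow_nonneg (by linarith [h.nonneg x]) _) (hη.nonneg x))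
  obtain ⟨C₁, c₁, c₂, hC₁, hc₂, H₁⟩ := h.integral_flux_le_of_grad_le (hq.trans_le hqp) le_rfl hs
    hcritp ht htp (hk.trans ((min_le_right _ _).trans (min_le_left _ _))) hM (D := D)
    (fun R η ε hR hη hε => by linarith [hD R η ε hR hη hε, hX q R η ε hη hε])
  obtain ⟨C₂, c₃, c₄, hC₂, hc₄, H₂⟩ := h.integral_flux_le_of_grad_le hq hqp hs
    hcritq ht htq2 (hk.trans ((min_le_right _ _).trans (min_le_right _ _))) hM (D := D)
    (fun R η ε hR hη hε => by linarith [hD R η ε hR hη hε, hX p R η ε hη hε])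
  refine ⟨m + 1, M, 2 * D + 2 * 2 ^ s + C₁ + C₂, c₁, c₂, c₃, c₄,
    by positivity, hc₂, hc₄, hcut, fun a b R η ha hb hR hη => ?_⟩
  have hR0 : 0 < R := by linarith
  set J := ∫ x in Metric.closedBall 0 (2 * R) \ Metric.ball 0 R, u x ^ s * η x with hJ
  have hJ0 : 0 ≤ J := integral_nonneg fun x =>
    mul_nonneg (Real.rpow_nonneg (h.nonneg x) _) (hη.nonneg x)
  set K := a ^ c₁ * b ^ (-c₂) with hK
  set K' := a ^ c₃ * b ^ (-c₄) with hK'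
  have hK0 : 0 ≤ K := by positivity
  have hK'0 : 0 ≤ K' := by positivity
  have hε : ∀ ε : ℝ, 0 < ε → ∫ x, u x ^ s * η x
      ≤ 2 * (a * D * (1 + ε ^ (s - t) * R ^ (n - n * t / s)) + b * 2 ^ s * J)
        + b * (C₁ + C₂) * (ε ^ s * R ^ (n : ℝ)) + (C₁ * K + C₂ * K') := by
    intro ε hε
    have y := h.energy_le hq hqp le_rfl hε hη.contDiff hη.hasCompactSupport hη.nonneg
    have y₁ := H₁ a b R η ε ha hb hR hη hε
    have y₂ := H₂ a b R η ε ha hb hR hη hε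
    simp only [neg_zero, Real.rpow_zero, one_mul, zero_mul, add_zero] at y y₁ y₂
    linarith
  have hlim : Tendsto (fun ε : ℝ => 2 * (a * D * (1 + ε ^ (s - t) * R ^ (n - n * t / s))
        + b * 2 ^ s * J) + b * (C₁ + C₂) * (ε ^ s * R ^ (n : ℝ)) + (C₁ * K + C₂ * K')) (𝓝[>] 0)
      (𝓝 (2 * (a * D * (1 + 0 ^ (s - t) * R ^ (n - n * t / s))
        + b * 2 ^ s * J) + b * (C₁ + C₂) * (0 ^ s * R ^ (n : ℝ)) + (C₁ * K + C₂ * K'))) := by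
    have c1 := Real.continuous_rpow_const hst.le
    have c2 := Real.continuous_rpow_const hs.le
    have : Continuous (fun ε : ℝ => 2 * (a * D * (1 + ε ^ (s - t) * R ^ (n - n * t / s))
        + b * 2 ^ s * J) + b * (C₁ + C₂) * (ε ^ s * R ^ (n : ℝ)) + (C₁ * K + C₂ * K')) := by
      fun_prop
    exact (this.tendsto 0).mono_left nhdsWithin_le_nhds
  have hle := ge_of_tendsto hlim (eventually_nhdsWithin_of_forall fun ε hε' => hε ε hε')
  rw [Real.zero_rpow hst.ne', Real.zero_rpow hs.ne'] at hle
  have h2s : (0 : ℝ) ≤ 2 ^ s := by positivity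
  have p1 : 0 ≤ (2 * 2 ^ s + C₁ + C₂) * a := by positivity
  have p2 : 0 ≤ (2 * D + C₁ + C₂) * b * J := by positivity
  have p3 : 0 ≤ (2 * D + 2 * 2 ^ s + C₂) * K := by positivity
  have p4 : 0 ≤ (2 * D + 2 * 2 ^ s + C₁) * K' := by positivity
  linarith

/-! ### The Liouville property. -/

theorem ae_eq_zero (h : IsSupersolution p q s u G) (hq : 1 < q)
    (hqp : q ≤ p) (hps : p - 1 < s) (hcritp : n * (s - p + 1) ≤ p * s)
    (hcritq : n * (s - q + 1) ≤ q * s) : ∀ᵐ x, u x = 0 := by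
  have hs : 0 < s := by linarith
  obtain ⟨k, M, C, c₁, c₂, c₃, c₄, hC, hc₂, hc₄, hcut, H⟩ :=
    h.exists_integral_source_le hq hqp hps hcritp hcritq
  have hu0 : ∀ x, 0 ≤ u x ^ s := fun x => Real.rpow_nonneg (h.nonneg x) _
  have hloc : ∀ R, IntegrableOn (fun x => u x ^ s) (Metric.closedBall 0 R) := by
    intro R
    have := h.memLpLoc.integrableOn_norm_rpow hs.le le_rfl (isCompact_closedBall 0 R)
    simpa only [Real.norm_of_nonneg (h.nonneg _)] using this
  have hI : ∀ {R η}, IsCutoff k M R η → Integrable (fun x => u x ^ s * η x) := by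
    intro R η hη
    simpa using h.integrable_source hs.le le_rfl one_pos hη.contDiff.continuous hη.hasCompactSupport
  have hball : ∀ {R η}, IsCutoff k M R η →
      ∫ x in Metric.ball 0 R, u x ^ s ≤ ∫ x, u x ^ s * η x := by
    intro R η hη
    calc _ = ∫ x in Metric.ball 0 R, u x ^ s * η x := by
          refine setIntegral_congr_fun measurableSet_ball fun x hx => ?_
          simp [hη.eq_one x hx]
      _ ≤ _ := setIntegral_le_integral (hI hη)
          (Eventually.of_forall fun x => mul_nonneg (hu0 x) (hη.nonneg x))
  have hcover : AECover volume (atTop : Filter ℝ)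
      (fun R => Metric.ball (0 : EuclideanSpace ℝ (Fin n)) R) := aecover_ball tendsto_id
  -- global integrability
  have hint : Integrable (fun x => u x ^ s) := by
    -- With `C * b ≤ 1 / 2` the annulus term is absorbed by the left side, which is finite because
    -- `η` has compact support.
    set b := 1 / (2 * (C + 1)) with hb
    have hb0 : 0 < b := by positivity
    have hCb : C * b ≤ 1 / 2 := by
      rw [hb, mul_one_div, div_le_div_iff₀ (by positivity) (by positivity)]; linarith
    refine hcover.integrable_of_integral_norm_bounded
      (2 * (C * 1 + C * (1 ^ c₁ * b ^ (-c₂) + 1 ^ c₃ * b ^ (-c₄))))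
      (fun R => (hloc R).mono_set Metric.ball_subset_closedBall) ?_
    filter_upwards [eventually_ge_atTop 1] with R hR
    obtain ⟨η, hη⟩ := hcut R (by linarith)
    simp only [Real.norm_of_nonneg (hu0 _)]
    refine (hball hη).trans ?_
    have y := H 1 b R η one_pos hb0 hR hη
    have hJ : ∫ x in Metric.closedBall 0 (2 * R) \ Metric.ball 0 R, u x ^ s * η x
        ≤ ∫ x, u x ^ s * η x := setIntegral_le_integral (hI hη)
          (Eventually.of_forall fun x => mul_nonneg (hu0 x) (hη.nonneg x))
    have hI0 : 0 ≤ ∫ x, u x ^ s * η x :=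
      integral_nonneg fun x => mul_nonneg (hu0 x) (hη.nonneg x)
    have h1 : C * b * (∫ x in Metric.closedBall 0 (2 * R) \ Metric.ball 0 R, u x ^ s * η x)
        ≤ 1 / 2 * ∫ x, u x ^ s * η x :=
      (mul_le_mul_of_nonneg_left hJ (by positivity)).trans (mul_le_mul_of_nonneg_right hCb hI0)
    linarith
  have hlim : Tendsto (fun R => ∫ x in Metric.ball 0 R, u x ^ s) atTop (𝓝 (∫ x, u x ^ s)) :=
    hcover.integral_tendsto_of_countably_generated hint
  set I := ∫ x, u x ^ s with hIdef
  -- Here `R → ∞` with `a` and `b` fixed: the annulus integral is at most a tail of the convergent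
  -- integral `I`.
  have hab : ∀ a b : ℝ, 0 < a → 0 < b →
      I ≤ C * a + C * (a ^ c₁ * b ^ (-c₂) + a ^ c₃ * b ^ (-c₄)) := by
    intro a b ha hb
    have hl : Tendsto (fun R => C * a + C * b * (I - ∫ x in Metric.ball 0 R, u x ^ s)
        + C * (a ^ c₁ * b ^ (-c₂) + a ^ c₃ * b ^ (-c₄))) atTop
        (𝓝 (C * a + C * b * (I - I) + C * (a ^ c₁ * b ^ (-c₂) + a ^ c₃ * b ^ (-c₄)))) :=
      (tendsto_const_nhds.add ((tendsto_const_nhds.sub hlim).const_mul _)).add tendsto_const_nhds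
    have := le_of_tendsto_of_tendsto hlim hl (by
      filter_upwards [eventually_ge_atTop 1] with R hR
      obtain ⟨η, hη⟩ := hcut R (by linarith)
      refine (hball hη).trans ((H a b R η ha hb hR hη).trans ?_)
      have hJ : ∫ x in Metric.closedBall 0 (2 * R) \ Metric.ball 0 R, u x ^ s * η x
          ≤ I - ∫ x in Metric.ball 0 R, u x ^ s := by
        have e : I - ∫ x in Metric.ball 0 R, u x ^ s = ∫ x in (Metric.ball 0 R)ᶜ, u x ^ s := by
          rw [hIdef, ← integral_add_compl measurableSet_ball hint]; ring
        rw [e]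
        calc _ ≤ ∫ x in Metric.closedBall 0 (2 * R) \ Metric.ball 0 R, u x ^ s :=
              setIntegral_mono (hI hη).integrableOn hint.integrableOn fun x =>
                mul_le_of_le_one_right (hu0 x) (hη.le_one x)
          _ ≤ _ := setIntegral_mono_set hint.integrableOn (Eventually.of_forall hu0)
              (Eventually.of_forall fun x hx => hx.2)
      gcongr)
    simpa using this
  -- Now `b → ∞`; the signs of `c₁` and `c₃` play no role since `a` is fixed.
  have ha : ∀ a : ℝ, 0 < a → I ≤ C * a := by
    intro a ha
    have hl : Tendsto (fun b : ℝ => C * a + C * (a ^ c₁ * b ^ (-c₂) + a ^ c₃ * b ^ (-c₄))) atTop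
        (𝓝 (C * a + C * (a ^ c₁ * 0 + a ^ c₃ * 0))) :=
      tendsto_const_nhds.add ((((tendsto_rpow_neg_atTop hc₂).const_mul _).add
        ((tendsto_rpow_neg_atTop hc₄).const_mul _)).const_mul _)
    have := ge_of_tendsto hl (by
      filter_upwards [eventually_gt_atTop 0] with b hb using hab a b ha hb)
    simpa using this
  have hI0 : I ≤ 0 := by
    have hl : Tendsto (fun a : ℝ => C * a) (𝓝[>] 0) (𝓝 (C * 0)) :=
      ((continuous_const_mul C).tendsto 0).mono_left nhdsWithin_le_nhds
    have := ge_of_tendsto hl (eventually_nhdsWithin_of_forall fun a ha' => ha a ha')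
    simpa using this
  have hz : I = 0 := le_antisymm hI0 (integral_nonneg hu0)
  have := (integral_eq_zero_iff_of_nonneg hu0 hint).1 hz
  filter_upwards [this] with x hx
  exact (Real.rpow_eq_zero (h.nonneg x) hs.ne').1 hx

end IsSupersolution

theorem corollary1p9 (n : ℕ) (hn : 1 ≤ n) (p q s : ℝ) (hq : 1 < q) (hqp : q ≤ p)
    (hs : p - 1 < s) (hcrit : ((n : ℝ) - q) * s ≤ (n : ℝ) * (q - 1))
    (u : EuclideanSpace ℝ (Fin n) → ℝ) (hu : IsNonnegWeakSolution p q s u) :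
    ∀ᵐ x, u x = 0 := by
  obtain ⟨w, G, huw, hw⟩ := hu.exists_isSupersolution
  have hcritq : n * (s - q + 1) ≤ q * s := by linarith
  -- Criticality passes from `q` to `p ≥ q`, as `n (s - z + 1)` decreases and `z s` increases in
  -- `z`.
  have hcritp : n * (s - p + 1) ≤ p * s := by
    have h1 : (n : ℝ) * (s - p + 1) ≤ n * (s - q + 1) :=
      mul_le_mul_of_nonneg_left (by linarith) (Nat.cast_nonneg n)
    have h2 : q * s ≤ p * s := mul_le_mul_of_nonneg_right hqp (by linarith)
    linarith
  filter_upwards [huw, hw.ae_eq_zero hq hqp hs hcritp hcritq] with x h1 h2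
  rw [h1, h2]
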